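/- **Theorem (generalization of the pruned model with post-pruning fine-tuning).** *Data.* Let $\mathcal P$ be an orthonormal set of $d$ patterns in $\mathbb R^d$, two of which, $o_1=o_{+1}$ and $o_2=o_{-1}$, are task-specific. A sample $(x,y)\sim\mathcal D$, $y\in\{\pm1\}$, has $n\ge l$ tokens $x^{(1)},\dots,x^{(n)}\in\mathcal P$, exactly one of which is task-specific, and this one equals $o_y$. Both labels have probability at least $\kappa>0$. Every other pattern appears in $x$ with the same conditional probability given either label, and with total probability at most $K/d$. *Model.* An expert-choice mixture-of-experts layer has $k\le K_k\sqrt d$ experts with routers $w_s\in\mathbb R^d$, hidden neurons $w_r^{(s)}\in\mathbb R^d$ ($r\le m$, $m\ge1$) and fixed heads $a^{(s)}\in\{\pm1\}$, each sign being carried by at least $\beta k$ experts. With $J_s(x)$ the set of the $l\ge 2$ tokens with the largest $\langle w_s,x^{(j)}\rangle$ (ties broken by the token index) and $G^{(s)}_j(x)=e^{\langle w_s,x^{(j)}\rangle}/\sum_{i\in J_s(x)}e^{\langle w_s,x^{(i)}\rangle}$ for $j\in J_s(x)$, $G^{(s)}_j(x)=0$ otherwise, the output is $f(x)=\sum_{s}a^{(s)}\sum_j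 G_j^{(s)}(x)\sum_{r}\mathrm{ReLU}\langle w^{(s)}_r,x^{(j)}\rangle$. *Pre-trained weights.* $\|w_s^{(0)}\|\le\frac12\log l$ and $\|w_r^{(s,0)}\|\le C_2$ for all $s,r$. For each sign $b=\pm1$ there is an important expert $s$ with $a^{(s)}=b$: given $y=b$, with probability at least $p_0$ the token $o_b$ lies in $J_s(x)$ and has gating value at least $1/l$; $|\langle w_s^{(0)},o_b-q\rangle|\ge c_p/d$ for all patterns $q\ne o_1,o_2$; and $\langle w_r^{(s,0)},o_b\rangle\ge0$ for at least $\varphi m$ of the neurons. *Algorithm.* All routers and neurons are trained by $T$ steps of SGD on the loss $1-yf(x)$, with fresh i.i.d. batches of size $B$ and learning rates $\eta_r$ (routers) and $\eta_e\le E$ (neurons); the gradient treats the sets $J_s(x)$ as fixed and uses $\mathrm{ReLU}'(0)=1$. Then, separately among the experts with each sign of the head, the fraction $1-\rho$ ($0\le\rho<1$) of experts (rounded down or up) with the largest norm changes $\|w_s^{(T)}\|-\|w_s^{(0)}\|$ is kept (ties broken arbitrarily) and the others are removed. The pruned layer is trained for $T'$ further SGD steps with the same $B,\eta_r,\eta_e$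 and fresh batches. Let $\hat f^{(T;\rho,T')}$ be the resulting model. *Claim.* Suppose, for fixed constants, $$\eta_r=\Theta\Big(\frac{\eta_e}{mdl^2}\Big),\quad B=\Omega(l^2d^2),\quad T=\Theta\Big(\frac{l^2\sqrt{d\log l}}{\eta_e}\Big),\quad T'=\Theta\Big(\frac{kl^2\sqrt{\log l}}{\eta_e}\Big),$$ where the upper constant of $\eta_r$ is small enough, the lower constant of $B$ is large enough, that of $T$ is large enough (depending on the lower constant of $\eta_r$), and that of $T'$ is large enough (depending moreover on the upper constant of $T$); the upper constants of $T$ and $T'$ and the lower constant of $\eta_r$ are otherwise arbitrary. Then there is a constant $C_\rho$ such that for every $0\le\rho\le1-C_\rho/k$, with high probability over the SGD batches (at least $1-d^{-N}$ for any prescribed $N$, once $d\ge d_0$), for all ways of breaking ties in the pruning, $$\mathbb P_{(x,y)\sim\mathcal D}\big[\,y\,\hat f^{(T;\rho,T')}(x)>0\,\big]=1 .$$ The thresholds on the constants, and $C_\rho$, depend only on $\kappa,K,p_0,c_p,\varphi,C_2,E,K_k,\beta$ and, where said above, on the other constants; not on $l,n,m,k,d,\eta_e$. The threshold $d_0$ may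 depend on $l$, on $N$ and on all constants, but not on $n,m,k,B,T,T',\eta_e,\eta_r,\rho,\mathcal D$ or the pre-trained weights. -/

import Mathlib

open MeasureTheory ProbabilityTheory

noncomputable section

namespace MoE

/-- The token space `ℝ^d` with the Euclidean norm. -/
abbrev Vec (d : ℕ) : Type := EuclideanSpace ℝ (Fin d)

/-- `true` encodes `+1` and `false` encodes `-1`, for labels and for the output heads. -/
def sgn (b : Bool) : ℝ := if b then 1 else -1

/-- A labelled sample: the pattern index of each of the `n` tokens, and the label. -/
abbrev Sample (d n : ℕ) : Type := (Fin n → Fin d) × Bool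

/-- The `n` tokens in `ℝ^d` of a sample, for the pattern set `P`. -/
def tokens {d n : ℕ} (P : Fin d → Vec d) (z : Sample d n) : Fin n → Vec d := fun j => P (z.1 j)

/-! ### The mixture-of-experts layer with expert-choice routing -/

/-- The trainable weights: one router and `m` hidden neurons for each of the `k` experts. -/
structure Weights (d m k : ℕ) where
  router : Fin k → Vec d
  neuron : Fin k → Fin m → Vec d

/-- The indices of the top `l` values of `g` (ties are broken in favour of the smaller index). -/
def topTokens {n : ℕ} (l : ℕ) (g : Fin n → ℝ) : Finset (Fin n) :=
  Finset.univ.filter fun j =>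
    (Finset.univ.filter fun i => g j < g i ∨ (g i = g j ∧ i < j)).card < l

/-- The tokens of `x` selected by the router `w`: those with the top `l` routing values. -/
def selected {d n : ℕ} (l : ℕ) (w : Vec d) (x : Fin n → Vec d) : Finset (Fin n) :=
  topTokens l fun j => inner ℝ w (x j)

/-- The gating value of token `j` at the router `w`. -/
def gate {d n : ℕ} (l : ℕ) (w : Vec d) (x : Fin n → Vec d) (j : Fin n) : ℝ :=
  if j ∈ selected l w x then
    Real.exp (inner ℝ w (x j)) / ∑ i ∈ selected l w x, Real.exp (inner ℝ w (x i))
  else 0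

/-- The sum of the ReLU activations of the hidden neurons `W` of one expert at the token `v`. -/
def act {d m : ℕ} (W : Fin m → Vec d) (v : Vec d) : ℝ :=
  ∑ r, max (inner ℝ (W r) v) 0

/-- The scalar output of the layer when only the experts in `R` are kept; `a` are the fixed heads.
The unpruned layer is the case `R = univ`. -/
def output {d m k n : ℕ} (l : ℕ) (a : Fin k → Bool) (R : Finset (Fin k)) (θ : Weights d m k)
    (x : Fin n → Vec d) : ℝ :=
  ∑ j, ∑ s ∈ R, sgn (a s) * act (θ.neuron s) (x j) * gate l (θ.router s) x j

/-! ### SGD on the loss `1 - y f(x)` -/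

/-- Gradient of `1 - y f(x)` in a router `w` whose expert has head `c` and hidden neurons `W`. -/
def routerGrad {d m n : ℕ} (l : ℕ) (c : Bool) (w : Vec d) (W : Fin m → Vec d)
    (x : Fin n → Vec d) (y : Bool) : Vec d :=
  -(sgn y * sgn c) • ∑ j ∈ selected l w x, ∑ i ∈ (selected l w x).erase j,
    (act W (x j) * gate l w x j * gate l w x i) • (x j - x i)

/-- Gradient of `1 - y f(x)` in a hidden neuron `v` of the expert with head `c` and router `w`
(the derivative of the ReLU at `0` is taken to be `1`). -/
def neuronGrad {d n : ℕ} (l : ℕ) (c : Bool) (w : Vec d) (v : Vec d)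
    (x : Fin n → Vec d) (y : Bool) : Vec d :=
  -(sgn y * sgn c) • ∑ j ∈ selected l w x,
    if 0 ≤ inner ℝ v (x j) then gate l w x j • x j else 0

/-- One step of mini-batch SGD with learning rates `ηr` (routers) and `ηe` (hidden neurons) on the
layer whose experts are those in `R`. -/
def sgdStep {d m k n B : ℕ} (P : Fin d → Vec d) (l : ℕ) (a : Fin k → Bool) (ηr ηe : ℝ)
    (R : Finset (Fin k)) (batch : Fin B → Sample d n) (θ : Weights d m k) : Weights d m k where
  router s :=
    if s ∈ R then
      θ.router s - ηr • ((B : ℝ)⁻¹ • ∑ b, routerGrad l (a s) (θ.router s) (θ.neuron s)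
        (tokens P (batch b)) (batch b).2)
    else θ.router s
  neuron s r :=
    if s ∈ R then
      θ.neuron s r - ηe • ((B : ℝ)⁻¹ • ∑ b, neuronGrad l (a s) (θ.router s) (θ.neuron s r)
        (tokens P (batch b)) (batch b).2)
    else θ.neuron s r

/-- The weights after `t` SGD steps from `θ₀`; step `t` uses the batch `ω (t, ·)`. -/
def sgd {d m k n B : ℕ} (P : Fin d → Vec d) (l : ℕ) (a : Fin k → Bool) (ηr ηe : ℝ)
    (R : Finset (Fin k)) (ω : ℕ × Fin B → Sample d n) (θ₀ : Weights d m k) : ℕ → Weights d m k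
  | 0 => θ₀
  | t + 1 => sgdStep P l a ηr ηe R (fun b => ω (t, b)) (sgd P l a ηr ηe R ω θ₀ t)

/-- The law of the samples drawn by SGD: all batch entries are i.i.d. with law `D`. -/
def batchLaw {d n : ℕ} (B : ℕ) (D : Measure (Sample d n)) [IsProbabilityMeasure D] :
    Measure (ℕ × Fin B → Sample d n) :=
  Measure.infinitePi fun _ => D

/-! ### Pruning -/

/-- The change of the `ℓ²` norm of the router of expert `s` between the weights `θ₀` and `θ`. -/
def normChange {d m k : ℕ} (θ₀ θ : Weights d m k) (s : Fin k) : ℝ :=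
  ‖θ.router s‖ - ‖θ₀.router s‖

/-- The experts with head `b`. -/
def headSet {k : ℕ} (a : Fin k → Bool) (b : Bool) : Finset (Fin k) :=
  Finset.univ.filter fun s => a s = b

/-- `R` is a set of experts kept by pruning with ratio `ρ` according to the scores `Δ`: among the
experts with each of the two heads, `R` keeps a fraction `1 - ρ` (rounded down or up), with the top
scores (ties broken arbitrarily). -/
def IsKept {k : ℕ} (a : Fin k → Bool) (ρ : ℝ) (Δ : Fin k → ℝ) (R : Finset (Fin k)) : Prop :=
  ∀ b : Bool,
    ⌊(1 - ρ) * ((headSet a b).card : ℝ)⌋₊ ≤ (R ∩ headSet a b).card ∧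
    (R ∩ headSet a b).card ≤ ⌈(1 - ρ) * ((headSet a b).card : ℝ)⌉₊ ∧
    ∀ s ∈ headSet a b, ∀ s' ∈ headSet a b, s ∈ R → s' ∉ R → Δ s' ≤ Δ s

/-- The weights after post-pruning fine-tuning: the full layer is trained for `T` steps from `θ₀`,
then the layer with the experts in `R` is trained for `T'` more steps on fresh batches. -/
def prunedWeights {d m k n B : ℕ} (P : Fin d → Vec d) (l : ℕ) (a : Fin k → Bool) (ηr ηe : ℝ)
    (R : Finset (Fin k)) (ω : ℕ × Fin B → Sample d n) (θ₀ : Weights d m k) (T T' : ℕ) :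
    Weights d m k :=
  sgd P l a ηr ηe R (fun i => ω (T + i.1, i.2)) (sgd P l a ηr ηe Finset.univ ω θ₀ T) T'

/-! ### The data model and the pre-trained model -/

/-- The event that the pattern `q` appears in the sample. -/
def appears {d n : ℕ} (q : Fin d) : Set (Sample d n) := {z | ∃ j, z.1 j = q}

/-- The event that the label is `b`. -/
def labelled {d n : ℕ} (b : Bool) : Set (Sample d n) := {z | z.2 = b}

/-- The data model. `o true`, `o false` are the indices of the two task-specific patterns; `κ`
bounds the class probabilities from below and `K / d` the frequency of every irrelevant pattern
from above. -/
structure IsDataModel {d n : ℕ} (κ K : ℝ) (o : Bool → Fin d) (D : Measure (Sample d n)) :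
    Prop where
  /-- The two task-specific patterns are different. -/
  ne : o true ≠ o false
  /-- A sample contains exactly one task-specific token, and it determines the label. -/
  task : ∀ᵐ z ∂D, (∃! j, z.1 j = o z.2) ∧ ∀ j, z.1 j ≠ o (!z.2)
  /-- Both classes have probability bounded away from zero. -/
  class_prob : ∀ b, κ ≤ D.real (labelled b)
  /-- An irrelevant pattern appears in both classes with the same probability. -/
  same_prob : ∀ q, (∀ b, q ≠ o b) →
    (cond D (labelled true)).real (appears q) = (cond D (labelled false)).real (appears q)
  /-- An irrelevant pattern appears with probability `O(1/d)`. -/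
  freq : ∀ q, (∀ b, q ≠ o b) → D.real (appears q) ≤ K / d

/-- The proficiency measure of a router `w` for the class `b`: the probability, given the label
`b`, that `w` selects the task-specific token of class `b` with gating value at least `1 / l`. -/
def proficiency {d n : ℕ} (P : Fin d → Vec d) (l : ℕ) (o : Bool → Fin d)
    (D : Measure (Sample d n)) (b : Bool) (w : Vec d) : ℝ :=
  (cond D (labelled b)).real
    {z | ∃ j ∈ selected l w (tokens P z), z.1 j = o b ∧ 1 / (l : ℝ) ≤ gate l w (tokens P z) j}

/-- The expert with router `w` and hidden neurons `W` is important for the class `b`: its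
proficiency is at least `p₀`, the component of the router along the task-specific pattern is
separated by at least `cp / d` from those along the irrelevant patterns, and a fraction at least
`φ` of the hidden neurons is activated by the task-specific pattern. -/
structure IsImportant {d n m : ℕ} (p₀ cp φ : ℝ) (P : Fin d → Vec d) (l : ℕ) (o : Bool → Fin d)
    (D : Measure (Sample d n)) (b : Bool) (w : Vec d) (W : Fin m → Vec d) : Prop where
  prof : p₀ ≤ proficiency P l o D b w
  separated : ∀ q, (∀ b', q ≠ o b') → cp / d ≤ |inner ℝ w (P (o b) - P q)|
  active : φ * m ≤ ((Finset.univ.filter fun r => 0 ≤ inner ℝ (W r) (P (o b))).card : ℝ)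

/-- The assumptions on the pre-trained weights `θ₀`: bounded routers and hidden neurons, and for
each class at least one important expert whose head has the sign of that class. -/
structure IsPretrained {d n m k : ℕ} (p₀ cp φ C₂ : ℝ) (P : Fin d → Vec d) (l : ℕ)
    (o : Bool → Fin d) (D : Measure (Sample d n)) (a : Fin k → Bool) (θ₀ : Weights d m k) :
    Prop where
  router_le : ∀ s, ‖θ₀.router s‖ ≤ 1 / 2 * Real.log l
  neuron_le : ∀ s r, ‖θ₀.neuron s r‖ ≤ C₂
  important : ∀ b, ∃ s, a s = b ∧ IsImportant p₀ cp φ P l o D b (θ₀.router s) (θ₀.neuron s)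

end MoE

end

/-! The loss is linear in the output, so the gradient of one expert involves no other expert: the
experts evolve independently, and a kept expert is trained during fine-tuning exactly as it would be
in the unpruned layer (`sgd_kept`). It therefore suffices to study single experts up to the horizon
`T + T'`, in the coordinates given by the orthonormal patterns (`IsRun`, `isRun_sgd`).

Let `p` be the task-specific pattern of the class of the head and `p'` the other one. Samples with
`p` always reward the expert, samples with `p'` always penalize it, and an irrelevant pattern is
seen too rarely to matter. Hence on every pattern except `p` the activation stays below `m * C`
(`IsRun.sum_max_le`), whereas on `p` it can only grow, and the router moves almost only along `p`
(`GoodRun.norm_router_sub_le`).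

For an important expert, the initial proficiency feeds `p` to the neurons, so their activation on
`p` grows linearly in time. Once it dominates `m * C`, the router component along `p` grows too,
quadratically in time. A small router learning rate ensures that the loss before this moment does
not destroy the initial separation `cp / d`; this is a bootstrap (`IsImportantRun.keepsMargin`).
After `T` steps the component is at least `3 / 2 * log l`, so the norm has grown by at least `log l`
(`GoodRun.important`).

Correctness on a class then follows from two cases (`GoodRun.output_pos`). If its important expert
is kept, that expert alone, with an activation of order `m * √d`, outweighs the at most `k ≤ Kk *
√d` opposing experts. If it is pruned, every kept expert with the same head has a norm change of at
least `log l`, so its router points strongly along `p`. A router gains at most `ηr` times the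
activation per step, so such growth certifies a large activation, again of order `m * √d`
(`GoodRun.le_act_of_router_ge`). As pruning keeps comparable numbers of experts of both signs, this
side wins for large `d`.

Randomness enters only through the frequencies of `d + 2` fixed sets of samples, namely the
appearance of each pattern and the proficiency sets of the two pre-trained important routers.
Hoeffding's inequality controls them at all times at once (`le_batchLaw_real`). -/

noncomputable section

namespace MoE

/-! ### The top `l` tokens -/

section TopTokens

variable {n : ℕ}

/-- The number of indices that precede `j` in the decreasing order of the values of `g`. -/
def tokenRank (g : Fin n → ℝ) (j : Fin n) : ℕ :=
  (Finset.univ.filter fun i => g j < g i ∨ (g i = g j ∧ i < j)).card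

lemma mem_topTokens {l : ℕ} {g : Fin n → ℝ} {j : Fin n} :
    j ∈ topTokens l g ↔ tokenRank g j < l := by
  simp [topTokens, tokenRank]

lemma tokenRank_lt_tokenRank {g : Fin n → ℝ} {i j : Fin n}
    (h : g j < g i ∨ (g i = g j ∧ i < j)) : tokenRank g i < tokenRank g j := by
  refine Finset.card_lt_card (Finset.ssubset_iff_of_subset ?_ |>.2 ⟨i, by simpa using h, by simp⟩)
  intro a ha
  simp only [Finset.mem_filter, Finset.mem_univ, true_and] at ha ⊢
  rcases h with h | ⟨h, h'⟩ <;> rcases ha with ha | ⟨ha, ha'⟩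
  · exact Or.inl (h.trans ha)
  · exact Or.inl (ha ▸ h)
  · exact Or.inl (h ▸ ha)
  · exact Or.inr ⟨ha.trans h, ha'.trans h'⟩

lemma tokenRank_injective (g : Fin n → ℝ) : Function.Injective (tokenRank g) := by
  intro i j hij
  by_contra hne
  have key : (g j < g i ∨ (g i = g j ∧ i < j)) ∨ (g i < g j ∨ (g j = g i ∧ j < i)) := by
    rcases lt_trichotomy (g i) (g j) with h | h | h
    · exact Or.inr (Or.inl h)
    · rcases lt_or_gt_of_ne hne with h' | h'
      · exact Or.inl (Or.inr ⟨h, h'⟩)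
      · exact Or.inr (Or.inr ⟨h.symm, h'⟩)
    · exact Or.inl (Or.inl h)
  rcases key with h | h
  · exact absurd hij (tokenRank_lt_tokenRank h).ne
  · exact absurd hij (tokenRank_lt_tokenRank h).ne'

lemma tokenRank_lt (g : Fin n → ℝ) (j : Fin n) : tokenRank g j < n := by
  calc tokenRank g j < (Finset.univ : Finset (Fin n)).card :=
        Finset.card_lt_card (Finset.ssubset_iff_of_subset (Finset.filter_subset _ _) |>.2
          ⟨j, Finset.mem_univ _, by simp⟩)
    _ = n := by simp

/-- The ranks are injective with values below `n`, hence a permutation of `0, …, n - 1`, and exactly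
`l` of them are below `l`. -/
lemma card_topTokens {l : ℕ} (hl : l ≤ n) (g : Fin n → ℝ) : (topTokens l g).card = l := by
  let r : Fin n → Fin n := fun j => ⟨tokenRank g j, tokenRank_lt g j⟩
  have hr : Function.Surjective r := Finite.surjective_of_injective fun i j h =>
    tokenRank_injective g (by simpa [r] using h)
  have himg : (topTokens l g).image (tokenRank g) = Finset.range l := by
    ext a
    simp only [Finset.mem_image, mem_topTokens, Finset.mem_range]
    constructor
    · rintro ⟨j, hj, rfl⟩
      exact hj
    · intro ha
      obtain ⟨j, hj⟩ := hr ⟨a, ha.trans_le hl⟩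
      have hj' : tokenRank g j = a := by simpa [r] using hj
      exact ⟨j, hj' ▸ ha, hj'⟩
  rw [← Finset.card_image_of_injective _ (tokenRank_injective g), himg, Finset.card_range]

lemma le_of_mem_topTokens_of_notMem {l : ℕ} {g : Fin n → ℝ} {i j : Fin n}
    (hj : j ∈ topTokens l g) (hi : i ∉ topTokens l g) : g i ≤ g j := by
  rw [mem_topTokens] at hi hj
  by_contra! h
  exact hi ((tokenRank_lt_tokenRank (Or.inl h)).trans hj)

/-- The top `l` tokens maximize the sum of a monotone function of the values. -/
lemma sum_le_sum_topTokens {l : ℕ} (hl : l ≤ n) (g : Fin n → ℝ) {f : ℝ → ℝ} (hf : Monotone f)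
    {S : Finset (Fin n)} (hS : S.card = l) :
    ∑ i ∈ S, f (g i) ≤ ∑ i ∈ topTokens l g, f (g i) := by
  set J := topTokens l g with hJ
  have hc : (S \ J).card = (J \ S).card :=
    Finset.card_sdiff_comm (hS.trans (card_topTokens hl g).symm)
  have h1 : ∑ i ∈ S \ J, f (g i) ≤ ∑ i ∈ J \ S, f (g i) := by
    rcases (S \ J).eq_empty_or_nonempty with h | h
    · have h' : J \ S = ∅ := by rw [← Finset.card_eq_zero, ← hc, h, Finset.card_empty]
      rw [h, h']
    · obtain ⟨i₀, hi₀, hmax⟩ := Finset.exists_max_image _ (fun i => f (g i)) h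
      calc ∑ i ∈ S \ J, f (g i) ≤ (S \ J).card • f (g i₀) := Finset.sum_le_card_nsmul _ _ _ hmax
        _ = (J \ S).card • f (g i₀) := by rw [hc]
        _ ≤ _ := Finset.card_nsmul_le_sum _ _ _ fun j hj =>
            hf (le_of_mem_topTokens_of_notMem (Finset.mem_sdiff.1 hj).1 (Finset.mem_sdiff.1 hi₀).2)
  have h2 := Finset.sum_inter_add_sum_sdiff S J fun i => f (g i)
  have h3 := Finset.sum_inter_add_sum_sdiff J S fun i => f (g i)
  rw [Finset.inter_comm] at h3
  linarith

end TopTokens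

/-! ### Gating values -/

section Gate

variable {d n l : ℕ}

lemma card_selected (hl : l ≤ n) (w : Vec d) (x : Fin n → Vec d) : (selected l w x).card = l :=
  card_topTokens hl _

lemma sum_exp_nonneg (w : Vec d) (x : Fin n → Vec d) :
    0 ≤ ∑ i ∈ selected l w x, Real.exp (inner ℝ w (x i)) :=
  Finset.sum_nonneg fun _ _ => (Real.exp_pos _).le

lemma gate_nonneg (w : Vec d) (x : Fin n → Vec d) (j : Fin n) : 0 ≤ gate l w x j := by
  unfold gate
  split_ifs
  · exact div_nonneg (Real.exp_pos _).le (sum_exp_nonneg w x)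
  · exact le_rfl

lemma sum_selected_gate (hl : 1 ≤ l) (hn : l ≤ n) (w : Vec d) (x : Fin n → Vec d) :
    ∑ j ∈ selected l w x, gate l w x j = 1 := by
  have hne : (selected l w x).Nonempty := by
    rw [← Finset.card_pos, card_selected hn]; omega
  have hpos : 0 < ∑ i ∈ selected l w x, Real.exp (inner ℝ w (x i)) :=
    Finset.sum_pos (fun _ _ => Real.exp_pos _) hne
  rw [Finset.sum_congr rfl fun j hj => by rw [gate, if_pos hj], ← Finset.sum_div,
    div_self hpos.ne']

lemma sum_gate (hl : 1 ≤ l) (hn : l ≤ n) (w : Vec d) (x : Fin n → Vec d) :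
    ∑ j, gate l w x j = 1 := by
  rw [← sum_selected_gate hl hn w x]
  refine (Finset.sum_subset (Finset.subset_univ _) fun j _ hj => ?_).symm
  rw [gate, if_neg hj]

/-- A token is selected with gating value at least `1 / l` by the routers that prefer it to all
other tokens. -/
lemma one_div_le_gate_of_forall_lt (hl : 1 ≤ l) (hn : l ≤ n) {w : Vec d} {x : Fin n → Vec d}
    {j : Fin n} (h : ∀ i, i ≠ j → inner ℝ w (x i) < inner ℝ w (x j)) :
    1 / (l : ℝ) ≤ gate l w x j := by
  have hmem : j ∈ selected l w x := by
    have : tokenRank (fun i => inner ℝ w (x i)) j = 0 := by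
      rw [tokenRank, Finset.card_eq_zero, Finset.filter_eq_empty_iff]
      rintro i -
      rcases eq_or_ne i j with rfl | hij
      · simp
      · have := h i hij
        rintro (h' | ⟨h', -⟩) <;> linarith
    exact mem_topTokens.2 (by omega)
  have hle : ∀ i, inner ℝ w (x i) ≤ inner ℝ w (x j) := fun i => by
    rcases eq_or_ne i j with rfl | hij
    · exact le_rfl
    · exact (h i hij).le
  have hpos : 0 < ∑ i ∈ selected l w x, Real.exp (inner ℝ w (x i)) :=
    Finset.sum_pos (fun _ _ => Real.exp_pos _) ⟨j, hmem⟩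
  have hsum : ∑ i ∈ selected l w x, Real.exp (inner ℝ w (x i)) ≤ l * Real.exp (inner ℝ w (x j)) := by
    have := Finset.sum_le_card_nsmul (selected l w x) (fun i => Real.exp (inner ℝ w (x i)))
      (Real.exp (inner ℝ w (x j))) fun i _ => Real.exp_le_exp.2 (hle i)
    rwa [card_selected hn, nsmul_eq_mul] at this
  have hl' : (0 : ℝ) < l := by exact_mod_cast hl
  rw [gate, if_pos hmem, div_le_div_iff₀ hl' hpos]
  linarith

/-- A token that is selected with gating value at least `1 / l` keeps half of this value if its
routing value relative to those of the other tokens drops by less than `σ ≤ log 2`, provided that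
its initial routing value is `σ`-separated from the others. -/
lemma one_div_le_gate_of_perturbation (hl : 1 ≤ l) (hn : l ≤ n) {w w' : Vec d}
    {x : Fin n → Vec d} {j : Fin n} {σ : ℝ} (hσ0 : 0 < σ) (hσ : σ ≤ Real.log 2)
    (hj : j ∈ selected l w x) (hg : 1 / (l : ℝ) ≤ gate l w x j)
    (hsep : ∀ i, i ≠ j → σ ≤ |inner ℝ w (x j) - inner ℝ w (x i)|)
    (hord : ∀ i, i ≠ j → -σ < (inner ℝ w' (x j) - inner ℝ w (x j)) -
      (inner ℝ w' (x i) - inner ℝ w (x i))) :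
    j ∈ selected l w' x ∧ 1 / (2 * l : ℝ) ≤ gate l w' x j := by
  have hmem : j ∈ selected l w' x := by
    rw [selected, mem_topTokens] at hj ⊢
    refine lt_of_le_of_lt (Finset.card_le_card ?_) hj
    intro i hi
    simp only [Finset.mem_filter, Finset.mem_univ, true_and] at hi ⊢
    rcases eq_or_ne i j with rfl | hij
    · simp at hi
    · have h1 := hord i hij
      have h2 := hsep i hij
      left
      -- If `i` did not beat `j` at `w`, then `j` would lead by at least `σ`; a relative loss below
      -- `σ` cannot let `i` overtake.
      by_contra! h3
      rw [abs_of_nonneg (by linarith)] at h2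
      rcases hi with hi | ⟨hi, -⟩ <;> linarith
  refine ⟨hmem, ?_⟩
  have hl' : (0 : ℝ) < l := by exact_mod_cast hl
  have hpos : 0 < ∑ i ∈ selected l w x, Real.exp (inner ℝ w (x i)) :=
    Finset.sum_pos (fun _ _ => Real.exp_pos _) ⟨j, hj⟩
  have hpos' : 0 < ∑ i ∈ selected l w' x, Real.exp (inner ℝ w' (x i)) :=
    Finset.sum_pos (fun _ _ => Real.exp_pos _) ⟨j, hmem⟩
  rw [gate, if_pos hj, div_le_div_iff₀ hl' hpos] at hg
  rw [gate, if_pos hmem, div_le_div_iff₀ (by positivity) hpos']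
  -- The two routers may select different tokens; the denominators remain comparable since the
  -- selection of `w` maximizes the exponential sum of `w`.
  have hex : ∑ i ∈ selected l w' x, Real.exp (inner ℝ w (x i)) ≤
      ∑ i ∈ selected l w x, Real.exp (inner ℝ w (x i)) :=
    sum_le_sum_topTokens hn (fun i => inner ℝ w (x i)) Real.exp_monotone (card_selected hn w' x)
  set D := inner ℝ w' (x j) - inner ℝ w (x j) with hD
  have hterm : ∀ i, Real.exp (inner ℝ w' (x i)) ≤
      (2 * Real.exp D) * Real.exp (inner ℝ w (x i)) := by
    intro i
    rw [← Real.exp_log (show (0 : ℝ) < 2 by norm_num), ← Real.exp_add, ← Real.exp_add,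
      Real.exp_le_exp]
    rcases eq_or_ne i j with rfl | hij
    · have := Real.log_pos (show (1 : ℝ) < 2 by norm_num)
      linarith
    · linarith [hord i hij]
  calc 1 * ∑ i ∈ selected l w' x, Real.exp (inner ℝ w' (x i))
      ≤ ∑ i ∈ selected l w' x, (2 * Real.exp D) * Real.exp (inner ℝ w (x i)) := by
        rw [one_mul]; exact Finset.sum_le_sum fun i _ => hterm i
    _ = (2 * Real.exp D) * ∑ i ∈ selected l w' x, Real.exp (inner ℝ w (x i)) := by
        rw [Finset.mul_sum]
    _ ≤ (2 * Real.exp D) * (Real.exp (inner ℝ w (x j)) * l) := by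
        refine mul_le_mul_of_nonneg_left ?_ (by positivity)
        linarith
    _ = Real.exp (inner ℝ w' (x j)) * (2 * l) := by
        have : Real.exp (inner ℝ w' (x j)) = Real.exp D * Real.exp (inner ℝ w (x j)) := by
          rw [← Real.exp_add]; congr 1; rw [hD]; ring
        rw [this]; ring

/-- An upper bound on the gating value of a token from bounds on the routing values. -/
lemma gate_le_of_bounds (hn : l ≤ n) {w : Vec d} {x : Fin n → Vec d} {j : Fin n} {γ U V : ℝ}
    (hγ : γ * (Real.exp (U + V) + (l - 1)) ≤ l - 1) (hγ0 : 0 ≤ γ) (hγ1 : γ ≤ 1) (hl : 1 ≤ l)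
    (hU : inner ℝ w (x j) ≤ U) (hV : ∀ i, i ≠ j → -V ≤ inner ℝ w (x i)) :
    gate l w x j ≤ 1 - γ := by
  unfold gate
  split_ifs with hj
  · have hpos : 0 < ∑ i ∈ selected l w x, Real.exp (inner ℝ w (x i)) :=
      Finset.sum_pos (fun _ _ => Real.exp_pos _) ⟨j, hj⟩
    rw [div_le_iff₀ hpos, ← Finset.add_sum_erase _ _ hj]
    have hS : (l - 1 : ℝ) * Real.exp (-V) ≤
        ∑ i ∈ (selected l w x).erase j, Real.exp (inner ℝ w (x i)) := by
      have := Finset.card_nsmul_le_sum ((selected l w x).erase j)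
        (fun i => Real.exp (inner ℝ w (x i))) (Real.exp (-V)) fun i hi =>
          Real.exp_le_exp.2 (hV i (Finset.ne_of_mem_erase hi))
      rw [Finset.card_erase_of_mem hj, card_selected hn, nsmul_eq_mul] at this
      push_cast [Nat.cast_sub hl] at this
      exact this
    set S := ∑ i ∈ (selected l w x).erase j, Real.exp (inner ℝ w (x i))
    set e := Real.exp (inner ℝ w (x j))
    have he : e ≤ Real.exp U := Real.exp_le_exp.2 hU
    -- This is `hγ` scaled by `exp (-V)`: `γ` is at most the softmax weight left to `l - 1` tokens
    -- of value `-V` competing with one of value `U`.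
    have hg : γ * Real.exp U ≤ (1 - γ) * S := by
      have h1 : γ * Real.exp U ≤ (1 - γ) * ((l - 1) * Real.exp (-V)) := by
        have h2 : Real.exp U = Real.exp (U + V) * Real.exp (-V) := by
          rw [← Real.exp_add]; congr 1; ring
        rw [h2]
        nlinarith [Real.exp_pos (-V)]
      exact h1.trans (mul_le_mul_of_nonneg_left hS (by linarith))
    nlinarith
  · linarith

end Gate

/-! ### The gating distribution on the patterns, and the gradients in coordinates -/

section GateMass

variable {d n l m k : ℕ}

/-- The total gating value that the router `w` gives to the tokens of `z` with pattern `q`. -/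
def gateMass (l : ℕ) (w : Vec d) (P : Fin d → Vec d) (z : Sample d n) (q : Fin d) : ℝ :=
  ∑ j, if z.1 j = q then gate l w (tokens P z) j else 0

variable {w : Vec d} {P : Fin d → Vec d} {z : Sample d n}

lemma gateMass_nonneg (q : Fin d) : 0 ≤ gateMass l w P z q :=
  Finset.sum_nonneg fun j _ => by split_ifs; exacts [gate_nonneg _ _ _, le_rfl]

lemma sum_gate_mul (F : Fin d → ℝ) :
    ∑ j, gate l w (tokens P z) j * F (z.1 j) = ∑ q, gateMass l w P z q * F q := by
  simp only [gateMass, Finset.sum_mul]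
  rw [Finset.sum_comm]
  refine Finset.sum_congr rfl fun j _ => ?_
  simp [ite_mul]

lemma sum_gateMass (hl : 1 ≤ l) (hn : l ≤ n) : ∑ q, gateMass l w P z q = 1 := by
  have := sum_gate_mul (l := l) (w := w) (P := P) (z := z) fun _ => 1
  simp only [mul_one] at this
  rw [← this, sum_gate hl hn]

lemma gateMass_le_one (hl : 1 ≤ l) (hn : l ≤ n) (q : Fin d) : gateMass l w P z q ≤ 1 := by
  rw [← sum_gateMass (w := w) (P := P) (z := z) hl hn]
  exact Finset.single_le_sum (fun q _ => gateMass_nonneg q) (Finset.mem_univ q)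

lemma gateMass_eq_zero {q : Fin d} (h : z ∉ appears q) : gateMass l w P z q = 0 :=
  Finset.sum_eq_zero fun j _ => if_neg fun hj => h ⟨j, hj⟩

lemma gateMass_le_indicator (hl : 1 ≤ l) (hn : l ≤ n) (q : Fin d) :
    gateMass l w P z q ≤ (appears q).indicator 1 z := by
  by_cases h : z ∈ appears q
  · simpa [h] using gateMass_le_one hl hn q
  · simp [h, gateMass_eq_zero h]

lemma gateMass_eq_gate {q : Fin d} {j : Fin n} (hj : z.1 j = q)
    (huniq : ∀ i, z.1 i = q → i = j) : gateMass l w P z q = gate l w (tokens P z) j := by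
  rw [gateMass, Finset.sum_eq_single j, if_pos hj]
  · intro i _ hij
    exact if_neg fun h => hij (huniq i h)
  · simp

lemma inner_pattern (hP : Orthonormal ℝ P) (p q : Fin d) :
    inner ℝ (P p) (P q) = if p = q then (1 : ℝ) else 0 :=
  orthonormal_iff_ite.1 hP p q

/-- The double sum is the covariance of `A` and `E` under the probability weights `G`, as for the
derivative of a softmax. -/
lemma sum_erase_sub {ι : Type*} [DecidableEq ι] (J : Finset ι) (A G E : ι → ℝ)
    (hG : ∑ i ∈ J, G i = 1) :
    ∑ j ∈ J, ∑ i ∈ J.erase j, A j * G j * G i * (E j - E i) =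
      ∑ j ∈ J, G j * E j * A j - (∑ j ∈ J, G j * E j) * ∑ j ∈ J, G j * A j := by
  have h1 : ∀ j ∈ J, ∑ i ∈ J.erase j, A j * G j * G i * (E j - E i) =
      G j * E j * A j - (G j * A j) * ∑ i ∈ J, G i * E i := by
    intro j hj
    have : ∑ i ∈ J.erase j, A j * G j * G i * (E j - E i) =
        ∑ i ∈ J, A j * G j * G i * (E j - E i) := by
      rw [← Finset.add_sum_erase _ _ hj]; simp
    rw [this]
    calc _ = ∑ i ∈ J, (G j * E j * A j * G i - (G j * A j) * (G i * E i)) :=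
          Finset.sum_congr rfl fun i _ => by ring
      _ = _ := by rw [Finset.sum_sub_distrib, ← Finset.mul_sum, ← Finset.mul_sum, hG, mul_one]
  rw [Finset.sum_congr rfl h1, Finset.sum_sub_distrib, ← Finset.sum_mul, mul_comm (∑ j ∈ J, _)]

lemma sum_selected_gate_mul (F : Fin d → ℝ) :
    ∑ j ∈ selected l w (tokens P z), gate l w (tokens P z) j * F (z.1 j) =
      ∑ q, gateMass l w P z q * F q := by
  rw [← sum_gate_mul]
  refine Finset.sum_subset (Finset.subset_univ _) fun j _ hj => ?_
  rw [gate, if_neg hj, zero_mul]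

/-- With `E` the indicator of `q` in `sum_erase_sub`, the router follows replicator-type dynamics: a
pattern gains according to the excess of its activation over the mean activation. -/
lemma inner_routerGrad (hP : Orthonormal ℝ P) (hl : 1 ≤ l) (hn : l ≤ n) (c y : Bool)
    (W : Fin m → Vec d) (q : Fin d) :
    inner ℝ (routerGrad l c w W (tokens P z) y) (P q) =
      -(sgn y * sgn c * (gateMass l w P z q *
        (act W (P q) - ∑ q', gateMass l w P z q' * act W (P q')))) := by
  unfold routerGrad
  rw [inner_smul_left, sum_inner]
  simp only [sum_inner, inner_smul_left, inner_sub_left, tokens, inner_pattern hP,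
    conj_trivial]
  have h := sum_erase_sub (selected l w (tokens P z)) (fun j => act W (P (z.1 j)))
    (gate l w (tokens P z)) (fun j => if z.1 j = q then (1 : ℝ) else 0)
    (sum_selected_gate hl hn w _)
  have e1 := sum_selected_gate_mul (l := l) (w := w) (P := P) (z := z)
    fun p => (if p = q then (1 : ℝ) else 0) * act W (P p)
  have e2 := sum_selected_gate_mul (l := l) (w := w) (P := P) (z := z)
    fun p => if p = q then (1 : ℝ) else 0
  have e3 := sum_selected_gate_mul (l := l) (w := w) (P := P) (z := z)
    fun p => act W (P p)
  simp only [ite_mul, one_mul, zero_mul, mul_ite, mul_one, mul_zero, Finset.sum_ite_eq',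
    Finset.mem_univ, if_true] at e1 e2 e3 h
  rw [e2, e3] at h
  unfold tokens at h e1 ⊢
  rw [e1] at h
  rw [h]
  ring

/-- By orthonormality the coordinates of a neuron decouple: whether it is active on `q`, and how it
moves along `q`, depends on its coordinate `q` alone. -/
lemma inner_neuronGrad (hP : Orthonormal ℝ P) (c y : Bool) (v : Vec d) (q : Fin d) :
    inner ℝ (neuronGrad l c w v (tokens P z) y) (P q) =
      -(if 0 ≤ inner ℝ v (P q) then sgn y * sgn c * gateMass l w P z q else 0) := by
  unfold neuronGrad
  rw [inner_smul_left, sum_inner]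
  have e2 := sum_selected_gate_mul (l := l) (w := w) (P := P) (z := z)
    fun p => if p = q then (if 0 ≤ inner ℝ v (P q) then (1 : ℝ) else 0) else 0
  simp only [mul_ite, mul_one, mul_zero, Finset.sum_ite_eq', Finset.mem_univ, if_true] at e2
  have e3 : ∀ j, inner ℝ (if 0 ≤ inner ℝ v (tokens P z j) then
      gate l w (tokens P z) j • tokens P z j else 0) (P q) =
      if z.1 j = q then if 0 ≤ inner ℝ v (P q) then gate l w (tokens P z) j else 0 else 0 := by
    intro j
    by_cases h : z.1 j = q
    · rw [if_pos h, ← h]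
      unfold tokens
      split_ifs
      · rw [inner_smul_left, inner_pattern hP, if_pos rfl]; simp
      · simp
    · rw [if_neg h]
      split_ifs
      · rw [inner_smul_left]
        unfold tokens
        rw [inner_pattern hP, if_neg h, mul_zero]
      · simp
  rw [Finset.sum_congr rfl fun j _ => e3 j, e2]
  split_ifs <;> simp

lemma output_eq (a : Fin k → Bool) (R : Finset (Fin k)) (θ : Weights d m k) :
    output l a R θ (tokens P z) =
      ∑ s ∈ R, sgn (a s) * ∑ q, gateMass l (θ.router s) P z q * act (θ.neuron s) (P q) := by
  unfold output
  rw [Finset.sum_comm]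
  refine Finset.sum_congr rfl fun s _ => ?_
  rw [← sum_gate_mul, Finset.mul_sum]
  refine Finset.sum_congr rfl fun j _ => ?_
  simp only [tokens]
  ring

lemma act_nonneg (W : Fin m → Vec d) (v : Vec d) : 0 ≤ act W v :=
  Finset.sum_nonneg fun _ _ => le_max_right _ _

lemma sgn_mul_self (b : Bool) : sgn b * sgn b = 1 := by cases b <;> simp [sgn]

lemma sgn_mul_of_ne {b c : Bool} (h : b ≠ c) : sgn b * sgn c = -1 := by
  cases b <;> cases c <;> simp [sgn] at h ⊢

end GateMass

/-! ### The training dynamics of one expert in coordinates -/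

/-- The average over a batch. -/
def batchMean {B : ℕ} (f : Fin B → ℝ) : ℝ := (B : ℝ)⁻¹ * ∑ b, f b

section BatchMean

variable {B : ℕ}

lemma batchMean_mono {f g : Fin B → ℝ} (h : ∀ b, f b ≤ g b) : batchMean f ≤ batchMean g :=
  mul_le_mul_of_nonneg_left (Finset.sum_le_sum fun b _ => h b) (by positivity)

lemma batchMean_nonneg {f : Fin B → ℝ} (h : ∀ b, 0 ≤ f b) : 0 ≤ batchMean f :=
  mul_nonneg (by positivity) (Finset.sum_nonneg fun b _ => h b)

lemma abs_batchMean_le {f g : Fin B → ℝ} (h : ∀ b, |f b| ≤ g b) : |batchMean f| ≤ batchMean g := by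
  rw [abs_le]
  constructor
  · rw [batchMean, batchMean, ← mul_neg, ← Finset.sum_neg_distrib]
    exact batchMean_mono fun b => (abs_le.1 (h b)).1
  · exact batchMean_mono fun b => (abs_le.1 (h b)).2

lemma batchMean_mul_const (f : Fin B → ℝ) (c : ℝ) :
    batchMean (fun b => f b * c) = batchMean f * c := by
  rw [batchMean, batchMean, ← Finset.sum_mul, mul_assoc]

lemma batchMean_const (hB : 0 < B) (c : ℝ) : batchMean (fun _ : Fin B => c) = c := by
  have : (B : ℝ) ≠ 0 := by positivity
  simp [batchMean, this]

end BatchMean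

/-- The dynamics of one expert in the coordinates given by the patterns: `u t` are the coordinates
of its router and `x t r` those of its `r`-th neuron after `t` steps, `π t b` is the gating
distribution on the patterns for the `b`-th sample of step `t`, and `ς t b` is the product of its
label and the head. The pattern `p` is the task-specific one of the class of the head and `p'` the
other one; the other patterns have frequency at most `ε` up to the horizon `H`. -/
structure IsRun {d m B : ℕ} (ηr ηe ε C : ℝ) (H : ℕ) (p p' : Fin d)
    (π : ℕ → Fin B → Fin d → ℝ) (ς : ℕ → Fin B → ℝ) (u : ℕ → Fin d → ℝ)
    (x : ℕ → Fin m → Fin d → ℝ) : Prop where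
  batch_pos : 0 < B
  ηr_nonneg : 0 ≤ ηr
  ηe_nonneg : 0 ≤ ηe
  ε_nonneg : 0 ≤ ε
  one_le : 1 ≤ C
  mass_nonneg : ∀ t b q, 0 ≤ π t b q
  mass_sum : ∀ t b, ∑ q, π t b q = 1
  sign : ∀ t b, (ς t b = 1 ∧ π t b p' = 0) ∨ (ς t b = -1 ∧ π t b p = 0)
  router : ∀ t q, u (t + 1) q = u t q + ηr * batchMean fun b =>
    ς t b * (π t b q * (∑ r, max (x t r q) 0 - ∑ q', π t b q' * ∑ r, max (x t r q') 0))
  neuron : ∀ t r q, x (t + 1) r q = x t r q +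
    if 0 ≤ x t r q then ηe * batchMean fun b => ς t b * π t b q else 0
  -- The unit gap up to `C` is the room for the motion along irrelevant patterns, which `freq` and
  -- `horizon` bound by `1`.
  init : ∀ r q, |x 0 r q| ≤ C - 1
  freq : ∀ q, q ≠ p → q ≠ p' → ∀ t,
    ∑ τ ∈ Finset.range t, batchMean (fun b => π τ b q) ≤ ε * t
  horizon : ηe * ε * H ≤ 1

namespace IsRun

variable {d m B : ℕ} {ηr ηe ε C : ℝ} {H : ℕ} {p p' : Fin d}
  {π : ℕ → Fin B → Fin d → ℝ} {ς : ℕ → Fin B → ℝ} {u : ℕ → Fin d → ℝ}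
  {x : ℕ → Fin m → Fin d → ℝ}

lemma mass_le_one (h : IsRun ηr ηe ε C H p p' π ς u x) (t : ℕ) (b : Fin B) (q : Fin d) :
    π t b q ≤ 1 := by
  rw [← h.mass_sum t b]
  exact Finset.single_le_sum (fun q _ => h.mass_nonneg t b q) (Finset.mem_univ q)

lemma abs_sign (h : IsRun ηr ηe ε C H p p' π ς u x) (t : ℕ) (b : Fin B) : |ς t b| = 1 := by
  rcases h.sign t b with ⟨h1, -⟩ | ⟨h1, -⟩ <;> simp [h1]

lemma sign_mul_mass (h : IsRun ηr ηe ε C H p p' π ς u x) (t : ℕ) (b : Fin B) :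
    ς t b * π t b p = π t b p := by
  rcases h.sign t b with ⟨h1, -⟩ | ⟨-, h2⟩
  · rw [h1, one_mul]
  · rw [h2, mul_zero]

lemma mul_C_nonneg (h : IsRun ηr ηe ε C H p p' π ς u x) : 0 ≤ m * C :=
  mul_nonneg (Nat.cast_nonneg _) (zero_le_one.trans h.one_le)

lemma sum_max_nonneg (t : ℕ) (q : Fin d) : 0 ≤ ∑ r, max (x t r q) 0 :=
  Finset.sum_nonneg fun _ _ => le_max_right _ _

lemma abs_neuron_sub_le (h : IsRun ηr ηe ε C H p p' π ς u x) (r : Fin m) (q : Fin d) (t : ℕ) :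
    |x t r q - x 0 r q| ≤ ηe * ∑ τ ∈ Finset.range t, batchMean fun b => π τ b q := by
  induction t with
  | zero => simp
  | succ t ih =>
    have hstep : |x (t + 1) r q - x t r q| ≤ ηe * batchMean fun b => π t b q := by
      rw [h.neuron, add_sub_cancel_left]
      split_ifs
      · rw [abs_mul, abs_of_nonneg h.ηe_nonneg]
        refine mul_le_mul_of_nonneg_left (abs_batchMean_le fun b => ?_) h.ηe_nonneg
        rw [abs_mul, h.abs_sign, one_mul, abs_of_nonneg (h.mass_nonneg _ _ _)]
      · rw [abs_zero]
        exact mul_nonneg h.ηe_nonneg (batchMean_nonneg fun b => h.mass_nonneg _ _ _)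
    rw [Finset.sum_range_succ, mul_add]
    calc |x (t + 1) r q - x 0 r q| = |(x t r q - x 0 r q) + (x (t + 1) r q - x t r q)| := by
          congr 1; ring
      _ ≤ _ := (abs_add_le _ _).trans (add_le_add ih hstep)

/-- The pattern `p'` carries weight only in samples with sign `-1`, so an active coordinate can only
decrease and an inactive one is frozen. -/
lemma neuron_other_le (h : IsRun ηr ηe ε C H p p' π ς u x) (r : Fin m) (t : ℕ) :
    x t r p' ≤ C := by
  induction t with
  | zero => linarith [(abs_le.1 (h.init r p')).2]
  | succ t ih =>
    rw [h.neuron]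
    have : batchMean (fun b => ς t b * π t b p') ≤ batchMean fun _ : Fin B => 0 :=
      batchMean_mono fun b => by
        rcases h.sign t b with ⟨-, h2⟩ | ⟨h1, -⟩
        · rw [h2, mul_zero]
        · rw [h1]; linarith [h.mass_nonneg t b p']
    rw [batchMean_const h.batch_pos] at this
    split_ifs
    · nlinarith [h.ηe_nonneg]
    · linarith

/-- Patterns other than the task-specific one of the expert's class keep a bounded activation. -/
lemma sum_max_le (h : IsRun ηr ηe ε C H p p' π ς u x) {t : ℕ} (ht : t ≤ H) {q : Fin d}
    (hq : q ≠ p) : ∑ r, max (x t r q) 0 ≤ m * C := by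
  have hx : ∀ r ∈ Finset.univ, max (x t r q) 0 ≤ C := fun r _ => by
    refine max_le ?_ (zero_le_one.trans h.one_le)
    rcases eq_or_ne q p' with rfl | hq'
    · exact h.neuron_other_le r t
    · have h1 := (abs_le.1 (h.abs_neuron_sub_le r q t)).2
      have h2 := mul_le_mul_of_nonneg_left (h.freq q hq hq' t) h.ηe_nonneg
      have h3 : ηe * (ε * t) ≤ ηe * ε * H := by
        rw [← mul_assoc]
        exact mul_le_mul_of_nonneg_left (by exact_mod_cast ht)
          (mul_nonneg h.ηe_nonneg h.ε_nonneg)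
      linarith [(abs_le.1 (h.init r q)).2, h.horizon]
  simpa using Finset.sum_le_card_nsmul _ _ _ hx

/-- All samples giving weight to `p` have sign `1`, so a neuron that starts active on `p` never
leaves the active region and accumulates the whole gating mass. -/
lemma neuron_eq_of_nonneg (h : IsRun ηr ηe ε C H p p' π ς u x) {r : Fin m} (hr : 0 ≤ x 0 r p)
    (t : ℕ) : x t r p =
      x 0 r p + ηe * ∑ τ ∈ Finset.range t, batchMean fun b => π τ b p := by
  induction t with
  | zero => simp
  | succ t ih =>
    have hnn : 0 ≤ ∑ τ ∈ Finset.range t, batchMean fun b => π τ b p :=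
      Finset.sum_nonneg fun τ _ => batchMean_nonneg fun b => h.mass_nonneg _ _ _
    rw [h.neuron, if_pos (by rw [ih]; exact add_nonneg hr (mul_nonneg h.ηe_nonneg hnn)), ih,
      Finset.sum_range_succ]
    simp only [h.sign_mul_mass]
    ring

lemma monotone_sum_max (h : IsRun ηr ηe ε C H p p' π ς u x) :
    Monotone fun t => ∑ r, max (x t r p) 0 := by
  refine monotone_nat_of_le_succ fun t => Finset.sum_le_sum fun r _ => max_le_max ?_ le_rfl
  rw [h.neuron]
  simp only [h.sign_mul_mass]
  have : 0 ≤ batchMean fun b => π t b p := batchMean_nonneg fun b => h.mass_nonneg _ _ _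
  split_ifs
  · linarith [mul_nonneg h.ηe_nonneg this]
  · linarith

lemma card_mul_le_sum_max (h : IsRun ηr ηe ε C H p p' π ς u x) (t : ℕ) :
    ((Finset.univ.filter fun r => 0 ≤ x 0 r p).card : ℝ) *
      (ηe * ∑ τ ∈ Finset.range t, batchMean fun b => π τ b p) ≤ ∑ r, max (x t r p) 0 := by
  rw [← nsmul_eq_mul]
  refine (Finset.card_nsmul_le_sum _ (fun r => max (x t r p) 0) _ fun r hr => ?_).trans
    (Finset.sum_le_sum_of_subset_of_nonneg (Finset.filter_subset _ _)
      fun _ _ _ => le_max_right _ _)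
  have hr' := (Finset.mem_filter.1 hr).2
  rw [h.neuron_eq_of_nonneg hr' t]
  exact le_max_of_le_left (by linarith)

lemma sum_max_le_add (h : IsRun ηr ηe ε C H p p' π ς u x) {t : ℕ} (ht : t ≤ H) (q : Fin d) :
    ∑ r, max (x t r q) 0 ≤ m * (C + ηe * t) := by
  have h0 : 0 ≤ ηe * t := mul_nonneg h.ηe_nonneg (Nat.cast_nonneg t)
  rcases eq_or_ne q p with rfl | hq
  · have hx : ∀ r ∈ Finset.univ, max (x t r q) 0 ≤ C + ηe * t := fun r _ => by
      refine max_le ?_ (by linarith [h.one_le])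
      have hs : ∑ τ ∈ Finset.range t, batchMean (fun b => π τ b q) ≤ t := by
        have := Finset.sum_le_card_nsmul (Finset.range t)
          (fun τ => batchMean fun b => π τ b q) 1 fun τ _ =>
            (batchMean_mono fun b => h.mass_le_one τ b q).trans_eq (batchMean_const h.batch_pos 1)
        simpa using this
      have h1 := (abs_le.1 (h.abs_neuron_sub_le r q t)).2
      have h2 := mul_le_mul_of_nonneg_left hs h.ηe_nonneg
      linarith [(abs_le.1 (h.init r q)).2]
    simpa [mul_add] using Finset.sum_le_card_nsmul _ _ _ hx
  · refine (h.sum_max_le ht hq).trans (mul_le_mul_of_nonneg_left ?_ (Nat.cast_nonneg _))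
    linarith

lemma mean_le_of_forall_le (h : IsRun ηr ηe ε C H p p' π ς u x) {t : ℕ} {b : Fin B} {a : ℝ}
    (ha : ∀ q, π t b q ≠ 0 → ∑ r, max (x t r q) 0 ≤ a) :
    ∑ q, π t b q * ∑ r, max (x t r q) 0 ≤ a := by
  calc ∑ q, π t b q * ∑ r, max (x t r q) 0 ≤ ∑ q, π t b q * a :=
        Finset.sum_le_sum fun q _ => by
          by_cases hq : π t b q = 0
          · simp [hq]
          · exact mul_le_mul_of_nonneg_left (ha q hq) (h.mass_nonneg _ _ _)
    _ = a := by rw [← Finset.sum_mul, h.mass_sum, one_mul]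

lemma mean_nonneg (h : IsRun ηr ηe ε C H p p' π ς u x) (t : ℕ) (b : Fin B) :
    0 ≤ ∑ q, π t b q * ∑ r, max (x t r q) 0 :=
  Finset.sum_nonneg fun _ _ => mul_nonneg (h.mass_nonneg _ _ _) (sum_max_nonneg _ _)

/-- The activation and its mean both lie in `[0, a]`. Only patterns that receive gating mass need
the bound `a`; in samples containing `p'` this excludes `p`, whose activation grows without a
uniform bound. -/
lemma abs_increment_le (h : IsRun ηr ηe ε C H p p' π ς u x) {t : ℕ} {b : Fin B} {a : ℝ}
    (ha : ∀ q, π t b q ≠ 0 → ∑ r, max (x t r q) 0 ≤ a) (q : Fin d) :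
    |ς t b * (π t b q * (∑ r, max (x t r q) 0 - ∑ q', π t b q' * ∑ r, max (x t r q') 0))| ≤
      π t b q * a := by
  rw [abs_mul, h.abs_sign, one_mul, abs_mul, abs_of_nonneg (h.mass_nonneg _ _ _)]
  by_cases hq : π t b q = 0
  · simp [hq]
  · refine mul_le_mul_of_nonneg_left (abs_le.2 ⟨?_, ?_⟩) (h.mass_nonneg _ _ _)
    · linarith [h.mean_le_of_forall_le ha, sum_max_nonneg (x := x) t q]
    · linarith [h.mean_nonneg t b, ha q hq]

/-- Routers hardly move in the direction of an irrelevant pattern. -/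
lemma abs_router_sub_le (h : IsRun ηr ηe ε C H p p' π ς u x) {q : Fin d} (hq : q ≠ p)
    (hq' : q ≠ p') {t : ℕ} (ht : t ≤ H) :
    |u t q - u 0 q| ≤ ηr * (m * (C + ηe * t)) * (ε * t) := by
  have key : ∀ s ≤ t, |u s q - u 0 q| ≤ ηr * (m * (C + ηe * t)) *
      ∑ τ ∈ Finset.range s, batchMean (fun b => π τ b q) := by
    intro s
    induction s with
    | zero => intro; simp
    | succ s ih =>
      intro hs
      have hC := h.one_le
      have hst : ηe * s ≤ ηe * t :=
        mul_le_mul_of_nonneg_left (by exact_mod_cast (by omega : s ≤ t)) h.ηe_nonneg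
      have hes : 0 ≤ ηe * s := mul_nonneg h.ηe_nonneg (Nat.cast_nonneg s)
      have hstep : |u (s + 1) q - u s q| ≤
          ηr * (m * (C + ηe * t)) * batchMean (fun b => π s b q) := by
        rw [h.router, add_sub_cancel_left, abs_mul, abs_of_nonneg h.ηr_nonneg, mul_assoc]
        refine mul_le_mul_of_nonneg_left ?_ h.ηr_nonneg
        rw [mul_comm, ← batchMean_mul_const]
        refine abs_batchMean_le fun b => h.abs_increment_le (fun q' _ => ?_) q
        exact (h.sum_max_le_add (by omega) q').trans
          (mul_le_mul_of_nonneg_left (by linarith) (Nat.cast_nonneg _))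
      rw [Finset.sum_range_succ, mul_add]
      calc |u (s + 1) q - u 0 q| = |(u s q - u 0 q) + (u (s + 1) q - u s q)| := by
            congr 1; ring
        _ ≤ _ := (abs_add_le _ _).trans (add_le_add (ih (by omega)) hstep)
  refine (key t le_rfl).trans (mul_le_mul_of_nonneg_left (h.freq q hq hq' t) ?_)
  have := h.one_le
  have := h.ηr_nonneg
  have := mul_nonneg h.ηe_nonneg (Nat.cast_nonneg (α := ℝ) t)
  positivity

/-- Routers hardly move in the direction of the task-specific pattern of the other class. -/
lemma abs_router_other_sub_le (h : IsRun ηr ηe ε C H p p' π ς u x) {t : ℕ}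
    (ht : t ≤ H) : |u t p' - u 0 p'| ≤ ηr * (m * C) * t := by
  induction t with
  | zero => simp
  | succ t ih =>
    have hstep : |u (t + 1) p' - u t p'| ≤ ηr * (m * C) := by
      rw [h.router, add_sub_cancel_left, abs_mul, abs_of_nonneg h.ηr_nonneg]
      refine mul_le_mul_of_nonneg_left ?_ h.ηr_nonneg
      rw [← batchMean_const h.batch_pos (m * C)]
      refine abs_batchMean_le fun b => ?_
      rcases h.sign t b with ⟨-, h2⟩ | ⟨-, h2⟩
      · rw [h2, zero_mul, mul_zero, abs_zero]
        exact h.mul_C_nonneg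
      -- Samples of sign `-1` give no weight to `p`, so the growing activation on `p` does not enter
      -- here.
      · refine (h.abs_increment_le (fun q hq => ?_) p').trans
          (mul_le_of_le_one_left h.mul_C_nonneg (h.mass_le_one _ _ _))
        exact h.sum_max_le (by omega) fun hqp => hq (hqp ▸ h2)
    have := ih (by omega)
    push_cast
    calc |u (t + 1) p' - u 0 p'| = |(u t p' - u 0 p') + (u (t + 1) p' - u t p')| := by
          congr 1; ring
      _ ≤ _ := by linarith [abs_add_le (u t p' - u 0 p') (u (t + 1) p' - u t p')]

lemma router_succ (h : IsRun ηr ηe ε C H p p' π ς u x) (t : ℕ) :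
    u (t + 1) p = u t p + ηr * batchMean fun b =>
      π t b p * (∑ r, max (x t r p) 0 - ∑ q', π t b q' * ∑ r, max (x t r q') 0) := by
  rw [h.router]
  congr 2
  congr 1
  ext b
  rw [← mul_assoc, h.sign_mul_mass]

lemma router_succ_le (h : IsRun ηr ηe ε C H p p' π ς u x) (t : ℕ) :
    u (t + 1) p ≤ u t p + ηr * ∑ r, max (x t r p) 0 := by
  rw [h.router_succ]
  refine add_le_add le_rfl (mul_le_mul_of_nonneg_left ?_ h.ηr_nonneg)
  refine (batchMean_mono (g := fun _ => ∑ r, max (x t r p) 0) fun b => ?_).trans_eq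
    (batchMean_const h.batch_pos _)
  have h1 := h.mass_nonneg t b p
  have h2 := h.mass_le_one t b p
  have h3 := h.mean_nonneg t b
  have h4 := sum_max_nonneg (x := x) t p
  nlinarith

/-- Each step gains at most `ηr` times the activation on `p`, which is monotone in time. Read
backwards, a large router component certifies a large activation; this is how experts without any
initial proficiency are controlled after pruning. -/
lemma router_sub_le (h : IsRun ηr ηe ε C H p p' π ς u x) (t : ℕ) :
    u t p - u 0 p ≤ ηr * t * ∑ r, max (x t r p) 0 := by
  have key : ∀ s ≤ t, u s p - u 0 p ≤ ηr * s * ∑ r, max (x t r p) 0 := by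
    intro s
    induction s with
    | zero => intro; simp
    | succ s ih =>
      intro hs
      have h1 := h.router_succ_le s
      have h2 := mul_le_mul_of_nonneg_left (h.monotone_sum_max (by omega : s ≤ t)) h.ηr_nonneg
      have h3 := ih (by omega)
      push_cast
      simp only at h2
      linarith
  exact key t le_rfl

/-- The mass `1 - π t b p` outside `p` sits on patterns of activation at most `m * C`, which bounds
the mean from above. -/
lemma increment_ge (h : IsRun ηr ηe ε C H p p' π ς u x) {t : ℕ} (ht : t ≤ H) (b : Fin B) :
    π t b p * (1 - π t b p) * (∑ r, max (x t r p) 0 - m * C) ≤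
      π t b p * (∑ r, max (x t r p) 0 - ∑ q', π t b q' * ∑ r, max (x t r q') 0) := by
  rw [mul_assoc]
  refine mul_le_mul_of_nonneg_left ?_ (h.mass_nonneg _ _ _)
  have hs : ∑ q', π t b q' * ∑ r, max (x t r q') 0 ≤
      π t b p * ∑ r, max (x t r p) 0 + (1 - π t b p) * (m * C) := by
    rw [← h.mass_sum t b, ← Finset.add_sum_erase _ _ (Finset.mem_univ p),
      ← Finset.add_sum_erase (a := p) _ (fun q => π t b q) (Finset.mem_univ p), add_sub_cancel_left,
      Finset.sum_mul]
    exact add_le_add le_rfl (Finset.sum_le_sum fun q hq => mul_le_mul_of_nonneg_left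
      (h.sum_max_le ht (Finset.ne_of_mem_erase hq)) (h.mass_nonneg _ _ _))
  linarith

lemma router_succ_ge (h : IsRun ηr ηe ε C H p p' π ς u x) {t : ℕ} (ht : t ≤ H) :
    u t p - ηr * (m * C) ≤ u (t + 1) p := by
  rw [h.router_succ, sub_eq_add_neg, ← mul_neg, ← batchMean_const h.batch_pos (-(m * C))]
  refine add_le_add le_rfl (mul_le_mul_of_nonneg_left (batchMean_mono fun b => ?_) h.ηr_nonneg)
  refine le_trans ?_ (h.increment_ge ht b)
  have h1 := h.mass_nonneg t b p
  have h2 := h.mass_le_one t b p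
  have h3 := h.mul_C_nonneg
  have h4 := sum_max_nonneg (x := x) t p
  have h5 : 0 ≤ π t b p * (1 - π t b p) := mul_nonneg h1 (by linarith)
  have h6 : π t b p * (1 - π t b p) ≤ 1 := by nlinarith
  nlinarith

lemma router_sub_ge (h : IsRun ηr ηe ε C H p p' π ς u x) {s t : ℕ} (hst : s ≤ t) (ht : t ≤ H) :
    u s p - ηr * (m * C) * (t - s : ℕ) ≤ u t p := by
  induction t, hst using Nat.le_induction with
  | base => simp
  | succ t hst ih =>
    have h1 := ih (by omega)
    have h2 := h.router_succ_ge (t := t) (by omega)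
    rw [Nat.succ_sub hst]
    push_cast
    linarith

/-- Lower bound for a step of the router from the samples in a set with indicator `χ`. -/
lemma router_succ_ge_of_le (h : IsRun ηr ηe ε C H p p' π ς u x) {t : ℕ} (ht : t ≤ H)
    (hA : m * C ≤ ∑ r, max (x t r p) 0) {χ : Fin B → ℝ} {θ : ℝ}
    (hχ : ∀ b, χ b * θ ≤ π t b p * (1 - π t b p)) :
    u t p + ηr * (batchMean χ * θ * (∑ r, max (x t r p) 0 - m * C)) ≤ u (t + 1) p := by
  rw [h.router_succ, ← batchMean_mul_const, ← batchMean_mul_const]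
  refine add_le_add le_rfl (mul_le_mul_of_nonneg_left (batchMean_mono fun b => ?_) h.ηr_nonneg)
  exact (mul_le_mul_of_nonneg_right (hχ b) (by linarith)).trans (h.increment_ge ht b)

lemma router_le_succ (h : IsRun ηr ηe ε C H p p' π ς u x) {t : ℕ} (ht : t ≤ H)
    (hA : m * C ≤ ∑ r, max (x t r p) 0) : u t p ≤ u (t + 1) p := by
  have := h.router_succ_ge_of_le ht hA (χ := 0) (θ := 0) fun b => by
    have h1 := h.mass_nonneg t b p
    have h2 := h.mass_le_one t b p
    simpa using mul_nonneg h1 (by linarith : (0 : ℝ) ≤ 1 - π t b p)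
  simpa [batchMean] using this

end IsRun

/-! ### Growth of the router of an important expert -/

/-- The margin by which the router prefers the task-specific pattern `p` to an irrelevant pattern
has dropped by less than `σ` after `t` steps. -/
def KeepsMargin {d : ℕ} (σ : ℝ) (p p' : Fin d) (u : ℕ → Fin d → ℝ) (t : ℕ) : Prop :=
  ∀ q, q ≠ p → q ≠ p' → -σ < (u t p - u 0 p) - (u t q - u 0 q)

/-- The dynamics of an important expert: `χ` is the indicator of a set of samples of probability
`a ≥ a₀`, on which the task-specific pattern has gating value at least `1 / (2 l)` as long as the
margins are kept, and at least a fraction `φ` of the neurons is activated by this pattern. The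
number `t₁` of steps makes the activation dominate that of the other patterns. -/
structure IsImportantRun {d m B : ℕ} (ηr ηe ε C : ℝ) (H : ℕ) (p p' : Fin d)
    (π : ℕ → Fin B → Fin d → ℝ) (ς : ℕ → Fin B → ℝ) (u : ℕ → Fin d → ℝ)
    (x : ℕ → Fin m → Fin d → ℝ) (χ : ℕ → Fin B → ℝ) (l a a₀ φ α σ t₁ : ℝ) : Prop
    extends IsRun ηr ηe ε C H p p' π ς u x where
  indicator : ∀ t b, χ t b = 0 ∨ χ t b = 1
  count : ∀ t, |∑ τ ∈ Finset.range t, batchMean (χ τ) - a * t| ≤ a₀ / 8 * t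
  l_pos : 0 < l
  a₀_pos : 0 < a₀
  a₀_le : a₀ ≤ a
  φ_pos : 0 < φ
  active : φ * m ≤ ((Finset.univ.filter fun r => 0 ≤ x 0 r p).card : ℝ)
  mass_ge : ∀ t ≤ H, KeepsMargin σ p p' u t → ∀ b, χ t b = 1 → 1 / (2 * l) ≤ π t b p
  -- The growth rate of the activation is the product of the active fraction `φ`, a lower bound `a₀
  -- / 2` for the observed frequency, and the gating value `1 / (2 * l)`.
  α_eq : α = φ * a₀ / (4 * l)
  t₁_eq : α * ηe * t₁ = 2 * C
  ηe_pos : 0 < ηe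

namespace IsImportantRun

variable {d m B : ℕ} {ηr ηe ε C : ℝ} {H : ℕ} {p p' : Fin d}
  {π : ℕ → Fin B → Fin d → ℝ} {ς : ℕ → Fin B → ℝ} {u : ℕ → Fin d → ℝ}
  {x : ℕ → Fin m → Fin d → ℝ} {χ : ℕ → Fin B → ℝ} {l a a₀ φ α σ t₁ : ℝ}

lemma α_pos (h : IsImportantRun ηr ηe ε C H p p' π ς u x χ l a a₀ φ α σ t₁) : 0 < α := by
  have := h.l_pos; have := h.a₀_pos; have := h.φ_pos
  rw [h.α_eq]; positivity

lemma t₁_pos (h : IsImportantRun ηr ηe ε C H p p' π ς u x χ l a a₀ φ α σ t₁) : 0 < t₁ := by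
  have h1 := h.t₁_eq
  have h2 := mul_pos h.α_pos h.ηe_pos
  by_contra! h3
  nlinarith [h.one_le]

lemma sum_max_ge (h : IsImportantRun ηr ηe ε C H p p' π ς u x χ l a a₀ φ α σ t₁) {t : ℕ}
    (ht : t ≤ H) (hord : ∀ τ < t, KeepsMargin σ p p' u τ) :
    m * α * ηe * t ≤ ∑ r, max (x t r p) 0 := by
  refine le_trans ?_ (h.card_mul_le_sum_max t)
  have hl := h.l_pos
  have hs : a₀ * t / (4 * l) ≤ ∑ τ ∈ Finset.range t, batchMean (fun b => π τ b p) := by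
    have h1 : (∑ τ ∈ Finset.range t, batchMean (χ τ)) * (1 / (2 * l)) ≤
        ∑ τ ∈ Finset.range t, batchMean (fun b => π τ b p) := by
      rw [Finset.sum_mul]
      refine Finset.sum_le_sum fun τ hτ => ?_
      rw [← batchMean_mul_const]
      have hτ' := Finset.mem_range.1 hτ
      refine batchMean_mono fun b => ?_
      rcases h.indicator τ b with h0 | h1
      · rw [h0, zero_mul]
        exact h.mass_nonneg _ _ _
      · rw [h1, one_mul]
        exact h.mass_ge τ (by omega) (hord τ hτ') b h1
    have h2 := (abs_le.1 (h.count t)).1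
    have h3 : a₀ * t ≤ a * t := mul_le_mul_of_nonneg_right h.a₀_le (Nat.cast_nonneg t)
    have h4 : a₀ * t / 2 ≤ ∑ τ ∈ Finset.range t, batchMean (χ τ) := by
      have := mul_nonneg h.a₀_pos.le (Nat.cast_nonneg (α := ℝ) t)
      linarith
    calc a₀ * t / (4 * l) = a₀ * t / 2 * (1 / (2 * l)) := by field_simp; ring
      _ ≤ _ := mul_le_mul_of_nonneg_right h4 (by positivity)
      _ ≤ _ := h1
  have hη := h.ηe_pos
  have ha := h.a₀_pos
  calc m * α * ηe * t = (φ * m) * (ηe * (a₀ * t / (4 * l))) := by rw [h.α_eq]; ring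
    _ ≤ (φ * m) * (ηe * ∑ τ ∈ Finset.range t, batchMean (fun b => π τ b p)) := by
        have := h.φ_pos
        gcongr
    _ ≤ _ := by
        refine mul_le_mul_of_nonneg_right h.active (mul_nonneg hη.le ?_)
        exact le_trans (by positivity) hs

lemma two_mul_le_sum_max (h : IsImportantRun ηr ηe ε C H p p' π ς u x χ l a a₀ φ α σ t₁) {t : ℕ}
    (ht : t ≤ H) (hord : ∀ τ < t, KeepsMargin σ p p' u τ) (ht₁ : t₁ ≤ t) :
    2 * (m * C) ≤ ∑ r, max (x t r p) 0 := by
  refine le_trans ?_ (h.sum_max_ge ht hord)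
  have := h.t₁_eq
  have h2 := mul_pos h.α_pos h.ηe_pos
  have h3 : 2 * C ≤ α * ηe * t := by
    rw [← this]; exact mul_le_mul_of_nonneg_left ht₁ h2.le
  nlinarith [Nat.cast_nonneg (α := ℝ) m]

lemma router_le_of_le (h : IsImportantRun ηr ηe ε C H p p' π ς u x χ l a a₀ φ α σ t₁) {s t : ℕ}
    (hst : s ≤ t) (ht : t ≤ H) (hord : ∀ τ < t, KeepsMargin σ p p' u τ) (ht₁ : t₁ ≤ s) :
    u s p ≤ u t p := by
  induction t, hst using Nat.le_induction with
  | base => exact le_rfl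
  | succ t hst ih =>
    refine (ih (by omega) fun τ hτ => hord τ (by omega)).trans ?_
    refine h.router_le_succ (by omega) ?_
    have := h.two_mul_le_sum_max (t := t) (by omega) (fun τ hτ => hord τ (by omega))
      (ht₁.trans (by exact_mod_cast hst))
    linarith [h.mul_C_nonneg]

/-- From time `t₁` on the activation on `p` exceeds that on the other patterns and the router cannot
decrease along `p`; the extra step accounts for `t₁` not being an integer. -/
lemma router_ge_init (h : IsImportantRun ηr ηe ε C H p p' π ς u x χ l a a₀ φ α σ t₁) {t : ℕ}
    (ht : t ≤ H) (hord : ∀ τ < t, KeepsMargin σ p p' u τ) :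
    u 0 p - ηr * (m * C) * (t₁ + 1) ≤ u t p := by
  have hc : 0 ≤ ηr * (m * C) := mul_nonneg h.ηr_nonneg h.mul_C_nonneg
  have hpos := h.t₁_pos
  induction t with
  | zero => nlinarith
  | succ t ih =>
    by_cases hle : ((t + 1 : ℕ) : ℝ) ≤ t₁ + 1
    · have := h.router_sub_ge (Nat.zero_le (t + 1)) ht
      rw [Nat.sub_zero] at this
      linarith [mul_le_mul_of_nonneg_left hle hc]
    · push_cast at hle
      exact (ih (by omega) fun τ hτ => hord τ (by omega)).trans
        (h.router_le_of_le (Nat.le_succ t) ht hord (by linarith))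

lemma router_growth (h : IsImportantRun ηr ηe ε C H p p' π ς u x χ l a a₀ φ α σ t₁) {s t : ℕ}
    (hst : s ≤ t) (ht : t ≤ H) (hord : ∀ τ < t, KeepsMargin σ p p' u τ) (ht₁ : t₁ ≤ s) {γ : ℝ}
    (hγ0 : 0 ≤ γ) (hγl : γ ≤ 1 / (2 * l))
    (hγ : ∀ τ, s ≤ τ → τ < t → ∀ b, χ τ b = 1 → π τ b p ≤ 1 - γ) :
    u s p + ηr * (γ / 2) * (m * α * ηe * s / 2) *
      (∑ τ ∈ Finset.range t, batchMean (χ τ) - ∑ τ ∈ Finset.range s, batchMean (χ τ)) ≤ u t p := by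
  induction t, hst using Nat.le_induction with
  | base => simp
  | succ t hst ih =>
    have h1 := ih (by omega) (fun τ hτ => hord τ (by omega))
      fun τ h1 h2 => hγ τ h1 (by omega)
    have hord' : ∀ τ < t, KeepsMargin σ p p' u τ := fun τ hτ => hord τ (by omega)
    have hst' : (s : ℝ) ≤ t := by exact_mod_cast hst
    have h2 := h.two_mul_le_sum_max (t := t) (by omega) hord' (ht₁.trans hst')
    have h3 := h.sum_max_ge (t := t) (by omega) hord'
    have h4 : m * α * ηe * s ≤ m * α * ηe * t := by
      have := h.α_pos; have := h.ηe_pos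
      gcongr
    have hC := h.mul_C_nonneg
    have h5 := h.router_succ_ge_of_le (t := t) (by omega) (by linarith) (χ := χ t) (θ := γ / 2)
      fun b => by
        have hn := h.mass_nonneg t b p
        have h1 := h.mass_le_one t b p
        rcases h.indicator t b with h0 | h0
        · rw [h0, zero_mul]
          exact mul_nonneg hn (by linarith)
        · have hlo := h.mass_ge t (by omega) (hord t (by omega)) b h0
          have hhi := hγ t hst (by omega) b h0
          rw [h0, one_mul]
          -- Whichever of `π` and `1 - π` is the larger is at least `1 / 2`, and the other is at
          -- least `γ`; so the product is at least `γ / 2`.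
          rcases le_total (π t b p) (1 / 2) with h6 | h6
          · nlinarith
          · nlinarith
    have hχ : 0 ≤ batchMean (χ t) := batchMean_nonneg fun b => by
      rcases h.indicator t b with h0 | h0 <;> simp [h0]
    -- The activation is at least `2 * (m * C)`, so at most half of it is lost by the subtraction.
    have h6 : m * α * ηe * s / 2 ≤ ∑ r, max (x t r p) 0 - m * C := by linarith
    have h7 : ηr * (batchMean (χ t) * (γ / 2) * (m * α * ηe * s / 2)) ≤
        ηr * (batchMean (χ t) * (γ / 2) * (∑ r, max (x t r p) 0 - m * C)) := by
      have := h.ηr_nonneg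
      gcongr
    rw [Finset.sum_range_succ]
    linarith

/-- On the second half of the time interval the activation is already linear in `t`, and at least
`a₀ * t / 4` useful samples arrive on average, whence the quadratic growth. The constant `64` is `2
* 8 * 4`, from `γ / 2`, `α / 8` and `a₀ / 4`. -/
lemma router_growth_half (h : IsImportantRun ηr ηe ε C H p p' π ς u x χ l a a₀ φ α σ t₁) {t : ℕ}
    (ht : t ≤ H) (hord : ∀ τ < t, KeepsMargin σ p p' u τ) (ht₁ : 2 * t₁ + 2 ≤ t) {γ : ℝ}
    (hγ0 : 0 ≤ γ) (hγl : γ ≤ 1 / (2 * l))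
    (hγ : ∀ τ : ℕ, t₁ ≤ τ → τ < t → ∀ b, χ τ b = 1 → π τ b p ≤ 1 - γ) :
    u 0 p - ηr * (m * C) * (t₁ + 1) + ηr * m * ηe * (γ * α * a₀ / 64) * (t : ℝ) ^ 2 ≤ u t p := by
  have hpos := h.t₁_pos
  have hlo : ((t : ℝ) - 1) / 2 ≤ (t / 2 : ℕ) := by
    have : t ≤ 2 * (t / 2) + 1 := by omega
    have : (t : ℝ) ≤ 2 * (t / 2 : ℕ) + 1 := by exact_mod_cast this
    linarith
  have hhi : ((t / 2 : ℕ) : ℝ) ≤ t / 2 := Nat.cast_div_le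
  set s := t / 2 with hs
  have hs₁ : t₁ ≤ s := by linarith
  have hst : s ≤ t := Nat.div_le_self t 2
  have h1 := h.router_growth hst ht hord hs₁ hγ0 hγl fun τ hτ hτ' =>
    hγ τ (hs₁.trans (by exact_mod_cast hτ)) hτ'
  have h2 := h.router_ge_init (t := s) (hst.trans ht) fun τ hτ => hord τ (by omega)
  have h3 := (abs_le.1 (h.count t)).1
  have h4 := (abs_le.1 (h.count s)).2
  have ha := h.a₀_pos
  have h5 : a₀ * t / 4 ≤
      ∑ τ ∈ Finset.range t, batchMean (χ τ) - ∑ τ ∈ Finset.range s, batchMean (χ τ) := by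
    have e1 : a * s ≤ a * (t / 2) := mul_le_mul_of_nonneg_left hhi (ha.le.trans h.a₀_le)
    have e2 : a₀ / 8 * s ≤ a₀ / 8 * (t / 2) := mul_le_mul_of_nonneg_left hhi (by linarith)
    have e3 : a₀ * t ≤ a * t := mul_le_mul_of_nonneg_right h.a₀_le (Nat.cast_nonneg t)
    have e4 : 0 ≤ a₀ * t := by positivity
    linarith
  have hα := h.α_pos
  have hη := h.ηe_pos
  have hr := h.ηr_nonneg
  have h6 : (t : ℝ) / 4 ≤ s := by linarith
  have h7 : ηr * (γ / 2) * (m * α * ηe * (t / 4) / 2) * (a₀ * t / 4) ≤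
      ηr * (γ / 2) * (m * α * ηe * s / 2) *
      (∑ τ ∈ Finset.range t, batchMean (χ τ) - ∑ τ ∈ Finset.range s, batchMean (χ τ)) := by
    gcongr
  calc _ = u 0 p - ηr * (m * C) * (t₁ + 1) +
        ηr * (γ / 2) * (m * α * ηe * (t / 4) / 2) * (a₀ * t / 4) := by ring
    _ ≤ _ := by linarith

/-- If the router learning rate and the frequency of the irrelevant patterns are small, the margins
are kept during the whole training. -/
lemma keepsMargin (h : IsImportantRun ηr ηe ε C H p p' π ς u x χ l a a₀ φ α σ t₁) (hσ : 0 < σ)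
    {γ : ℝ} (hγ0 : 0 ≤ γ) (hγl : γ ≤ 1 / (2 * l))
    (hγ : ∀ τ ≤ H, ∀ b, χ τ b = 1 → π τ b p ≤ 1 - γ)
    (hdrop : ηr * (m * C) * (t₁ + 1) ≤ σ / 4)
    (hdrift : ηr * (m * (C + ηe * (2 * t₁ + 2))) * (ε * (2 * t₁ + 2)) ≤ σ / 4)
    (hε : (1 + α) * ε ≤ γ * α * a₀ / 64) {t : ℕ} (ht : t ≤ H) : KeepsMargin σ p p' u t := by
  -- Bootstrap: margins at all earlier times yield the growth estimates up to `t`, which yield the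
  -- margin at `t`.
  induction t using Nat.strong_induction_on with
  | _ t ih =>
    have hord : ∀ τ < t, KeepsMargin σ p p' u τ := fun τ hτ => ih τ hτ (by omega)
    intro q hq hq'
    have h1 := (abs_le.1 (h.abs_router_sub_le hq hq' ht)).2
    have hr := h.ηr_nonneg
    have hη := h.ηe_pos
    have hε0 := h.ε_nonneg
    have hC := h.one_le
    have hα := h.α_pos
    rcases le_total (2 * t₁ + 2) (t : ℝ) with hle | hle
    -- At late times the drift along irrelevant patterns is quadratic in `t` as well, because `C ≤ α
    -- * ηe * t`; `hε` compares the two coefficients. At early times, loss and drift are each at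
    -- most `σ / 4`.
    · have h2 := h.router_growth_half ht hord hle hγ0 hγl fun τ _ hτ => hγ τ (by omega)
      have hCt : C ≤ α * (ηe * t) := by
        have := h.t₁_eq
        have h3 := h.t₁_pos
        have : α * ηe * t₁ ≤ α * ηe * t := by
          gcongr; linarith
        linarith
      have h3 : ηr * (m * (C + ηe * t)) * (ε * t) ≤
          ηr * m * ηe * (γ * α * a₀ / 64) * (t : ℝ) ^ 2 := by
        calc ηr * (m * (C + ηe * t)) * (ε * t) ≤
              ηr * (m * (α * (ηe * t) + ηe * t)) * (ε * t) := by gcongr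
          _ = ηr * m * ηe * ((1 + α) * ε) * (t : ℝ) ^ 2 := by ring
          _ ≤ _ := by gcongr
      linarith
    · have h2 := h.router_ge_init ht hord
      have h3 : ηr * (m * (C + ηe * t)) * (ε * t) ≤
          ηr * (m * (C + ηe * (2 * t₁ + 2))) * (ε * (2 * t₁ + 2)) := by
        have := h.t₁_pos
        gcongr
      linarith

/-- After sufficiently many steps, the router has a large component along the task-specific
pattern. -/
lemma router_ge (h : IsImportantRun ηr ηe ε C H p p' π ς u x χ l a a₀ φ α σ t₁) {T : ℕ}
    (hT : T ≤ H) (hord : ∀ τ < T, KeepsMargin σ p p' u τ) (ht₁ : 2 * t₁ + 2 ≤ T) {γ V : ℝ}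
    (hγ0 : 0 ≤ γ) (hγl : γ ≤ 1 / (2 * l))
    (hγ : ∀ τ ≤ H, u τ p ≤ V → ∀ b, χ τ b = 1 → π τ b p ≤ 1 - γ)
    (hV : V ≤ u 0 p - ηr * (m * C) * (t₁ + 1) +
      ηr * m * ηe * (γ * α * a₀ / 64) * (T : ℝ) ^ 2) : V ≤ u T p := by
  -- If the component ended below `V`, monotonicity after `t₁` would keep it below `V` since then,
  -- so the gate would stay unsaturated and the growth bound would apply.
  by_contra! hlt
  refine absurd (h.router_growth_half hT hord ht₁ hγ0 hγl fun τ hτ hτT => ?_) (by linarith)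
  exact hγ τ (by omega) ((h.router_le_of_le hτT.le hT hord hτ).trans hlt.le)

end IsImportantRun

/-! ### Concentration of the batches -/

section Concentration

variable {d n B : ℕ}

instance (D : Measure (Sample d n)) [IsProbabilityMeasure D] :
    IsProbabilityMeasure (batchLaw B D) := by
  unfold batchLaw; infer_instance

/-- The accumulated frequency of the samples in `A` among the first `t` batches. -/
def prefixCount (A : Set (Sample d n)) (ω : ℕ × Fin B → Sample d n) (t : ℕ) : ℝ :=
  ∑ τ ∈ Finset.range t, batchMean fun b => A.indicator 1 (ω (τ, b))

lemma measurable_prefixCount (A : Set (Sample d n)) (t : ℕ) :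
    Measurable fun ω : ℕ × Fin B → Sample d n => prefixCount A ω t := by
  unfold prefixCount batchMean
  refine Finset.measurable_sum _ fun τ _ => Measurable.const_mul (Finset.measurable_sum _
    fun b _ => ?_) _
  exact (measurable_of_countable (A.indicator (1 : Sample d n → ℝ))).comp (measurable_pi_apply _)

lemma measureReal_sum_ge_le (D : Measure (Sample d n)) [IsProbabilityMeasure D]
    (f : Sample d n → ℝ) (hf : ∀ z, f z ∈ Set.Icc (0 : ℝ) 1) (s : Finset (ℕ × Fin B)) {ε : ℝ}
    (hε : 0 ≤ ε) :
    (batchLaw B D).real {ω | ε ≤ ∑ i ∈ s, (f (ω i) - ∫ z, f z ∂D)} ≤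
      Real.exp (-2 * ε ^ 2 / s.card) := by
  have hfm : Measurable f := measurable_of_countable f
  have hind : iIndepFun (fun (i : ℕ × Fin B) (ω : ℕ × Fin B → Sample d n) =>
      f (ω i) - ∫ z, f z ∂D) (batchLaw B D) :=
    iIndepFun_infinitePi (X := fun _ z => f z - ∫ z, f z ∂D) fun _ => hfm.sub_const _
  have hsub : ∀ i ∈ s, HasSubgaussianMGF (fun ω : ℕ × Fin B → Sample d n =>
      f (ω i) - ∫ z, f z ∂D) ((‖(1 : ℝ) - 0‖₊ / 2) ^ 2) (batchLaw B D) := by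
    intro i _
    have hmp : MeasurePreserving (Function.eval i) (batchLaw B D) D :=
      measurePreserving_eval_infinitePi (fun _ => D) i
    have := hasSubgaussianMGF_of_mem_Icc (μ := batchLaw B D)
      (X := fun ω => f (ω i)) (hfm.comp (measurable_pi_apply i)).aemeasurable
      (Filter.Eventually.of_forall fun ω => hf (ω i))
    have hint : ∫ ω, f (ω i) ∂(batchLaw B D) = ∫ z, f z ∂D := by
      have h := integral_map (μ := batchLaw B D) hmp.measurable.aemeasurable
        (f := f) hfm.aestronglyMeasurable
      rw [hmp.map_eq] at h
      exact h.symm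
    rwa [hint] at this
  refine (HasSubgaussianMGF.measure_sum_ge_le_of_iIndepFun hind hsub hε).trans_eq ?_
  congr 1
  simp only [sub_zero, nnnorm_one, Finset.sum_const, nsmul_eq_mul]
  push_cast
  by_cases hs : (s.card : ℝ) = 0
  · simp [hs]
  · field_simp

/-- **Hoeffding's inequality** for the accumulated frequencies. -/
lemma measureReal_prefixCount_le (D : Measure (Sample d n)) [IsProbabilityMeasure D] (hB : 0 < B)
    (A : Set (Sample d n)) {δ : ℝ} (hδ : 0 ≤ δ) (t : ℕ) :
    (batchLaw B D).real {ω | δ * t < |prefixCount A ω t - D.real A * t|} ≤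
      2 * Real.exp (-2 * δ ^ 2 * B) ^ t := by
  have hB' : (0 : ℝ) < B := by exact_mod_cast hB
  rcases Nat.eq_zero_or_pos t with rfl | ht
  · simp only [prefixCount, pow_zero]
    simp
  have ht' : (0 : ℝ) < t := by exact_mod_cast ht
  have hAm : MeasurableSet A := A.to_countable.measurableSet
  set f : Sample d n → ℝ := A.indicator 1 with hf
  have hf01 : ∀ z, f z ∈ Set.Icc (0 : ℝ) 1 := fun z => by
    by_cases hz : z ∈ A <;> simp [hf, hz]
  have hint : ∫ z, f z ∂D = D.real A := integral_indicator_one hAm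
  set s : Finset (ℕ × Fin B) := Finset.range t ×ˢ Finset.univ with hs
  have hcard : (s.card : ℝ) = t * B := by simp [hs]
  have hsum : ∀ ω : ℕ × Fin B → Sample d n,
      ∑ i ∈ s, (f (ω i) - D.real A) = B * (prefixCount A ω t - D.real A * t) := by
    intro ω
    rw [Finset.sum_sub_distrib, Finset.sum_const, nsmul_eq_mul, hcard, hs, Finset.sum_product]
    simp only [prefixCount, batchMean, ← Finset.mul_sum, ← hf]
    field_simp
  have hexp : Real.exp (-2 * δ ^ 2 * B) ^ t =
      Real.exp (-2 * (B * (δ * t)) ^ 2 / s.card) := by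
    rw [← Real.exp_nat_mul, hcard]
    congr 1
    field_simp
  have hnn : 0 ≤ B * (δ * t) := by positivity
  have h1 := measureReal_sum_ge_le D f hf01 s hnn
  -- The lower tail is the upper tail of the complementary indicator.
  have h2 := measureReal_sum_ge_le D (fun z => 1 - f z)
    (fun z => ⟨by linarith [(hf01 z).2], by linarith [(hf01 z).1]⟩) s hnn
  have hint2 : ∫ z, (1 - f z) ∂D = 1 - D.real A := by
    rw [integral_sub (integrable_const _)
      (Integrable.of_mem_Icc 0 1 (measurable_of_countable f).aemeasurable
        (Filter.Eventually.of_forall hf01)), hint]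
    simp
  rw [hint2] at h2
  rw [hint] at h1
  have hsum2 : ∀ ω : ℕ × Fin B → Sample d n,
      ∑ i ∈ s, (1 - f (ω i) - (1 - D.real A)) = -(B * (prefixCount A ω t - D.real A * t)) := by
    intro ω
    rw [← hsum, ← Finset.sum_neg_distrib]
    exact Finset.sum_congr rfl fun i _ => by ring
  simp only [hsum2, hsum] at h1 h2
  rw [hexp, two_mul]
  refine (measureReal_mono ?_).trans ((measureReal_union_le _ _).trans (add_le_add h1 h2))
  intro ω hω
  rcases lt_abs.1 (show δ * t < |prefixCount A ω t - D.real A * t| from hω) with h | h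
  · exact Or.inl (mul_le_mul_of_nonneg_left h.le hB'.le)
  · refine Or.inr ?_
    show B * (δ * t) ≤ -(B * (prefixCount A ω t - D.real A * t))
    rw [← mul_neg]
    exact mul_le_mul_of_nonneg_left h.le hB'.le

/-- With high probability, all samples have an almost sure property, and the frequencies of finitely
many sets of samples are close to their probabilities at all times. -/
lemma le_batchLaw_real (D : Measure (Sample d n)) [IsProbabilityMeasure D] (hB : 0 < B)
    {Q : Sample d n → Prop} (hQ : ∀ᵐ z ∂D, Q z) {ι : Type*} [Fintype ι] (A : ι → Set (Sample d n))
    {δ : ℝ} (hδ : 0 ≤ δ) (hr : Real.exp (-2 * δ ^ 2 * B) ≤ 1 / 2)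
    {S : Set (ℕ × Fin B → Sample d n)}
    (hS : ∀ ω, (∀ i, Q (ω i)) → (∀ i t, |prefixCount (A i) ω t - D.real (A i) * t| ≤ δ * t) →
      ω ∈ S) :
    1 - 4 * Fintype.card ι * Real.exp (-2 * δ ^ 2 * B) ≤ (batchLaw B D).real S := by
  set r := Real.exp (-2 * δ ^ 2 * B) with hrdef
  have hr0 : 0 < r := Real.exp_pos _
  set μ := batchLaw B D with hμ
  set bad : ι → ℕ → Set (ℕ × Fin B → Sample d n) := fun i t =>
    {ω | δ * t < |prefixCount (A i) ω t - D.real (A i) * t|} with hbad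
  have hbadm : ∀ i t, MeasurableSet (bad i t) := fun i t =>
    measurableSet_lt measurable_const
      ((measurable_prefixCount (A i) t).sub_const _).abs
  -- Time `0` must be removed, since there the Hoeffding bound is the useless value `2`; from time
  -- `1` on, the bounds form a geometric series, so that controlling all times costs only a constant
  -- factor.
  have hbad0 : ∀ i, bad i 0 = ∅ := fun i => by
    simp [hbad, prefixCount]
  set notQ : Set (ℕ × Fin B → Sample d n) := {ω | ¬ ∀ i, Q (ω i)} with hnotQ
  have hQ0 : μ notQ = 0 := by
    have : ∀ᵐ ω ∂μ, ∀ i, Q (ω i) := by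
      rw [ae_all_iff]
      intro i
      have hmp : MeasurePreserving (Function.eval i) μ D :=
        measurePreserving_eval_infinitePi (fun _ => D) i
      exact hmp.quasiMeasurePreserving.ae hQ
    exact this
  have hunion : ∀ i, μ (⋃ t, bad i t) ≤ ENNReal.ofReal (4 * r) := by
    intro i
    have hle : ∀ t, μ (bad i (t + 1)) ≤ ENNReal.ofReal (2 * r ^ (t + 1)) := fun t => by
      rw [← ENNReal.ofReal_toReal (measure_ne_top μ (bad i (t + 1)))]
      exact ENNReal.ofReal_le_ofReal (measureReal_prefixCount_le D hB (A i) hδ (t + 1))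
    have hsum : HasSum (fun t : ℕ => 2 * r ^ (t + 1)) (2 * (r * (1 - r)⁻¹)) := by
      have := ((hasSum_geometric_of_lt_one hr0.le (by linarith)).mul_left r).mul_left 2
      simpa [pow_succ'] using this
    calc μ (⋃ t, bad i t) = μ (⋃ t, bad i (t + 1)) := by
          congr 1
          ext ω
          simp only [Set.mem_iUnion]
          constructor
          · rintro ⟨t, ht⟩
            cases t with
            | zero => rw [hbad0] at ht; exact ht.elim
            | succ t => exact ⟨t, ht⟩
          · rintro ⟨t, ht⟩
            exact ⟨t + 1, ht⟩
      _ ≤ ∑' t, μ (bad i (t + 1)) := measure_iUnion_le _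
      _ ≤ ∑' t, ENNReal.ofReal (2 * r ^ (t + 1)) := ENNReal.tsum_le_tsum hle
      _ = ENNReal.ofReal (2 * (r * (1 - r)⁻¹)) := by
          rw [← ENNReal.ofReal_tsum_of_nonneg (fun t => by positivity) hsum.summable, hsum.tsum_eq]
      _ ≤ ENNReal.ofReal (4 * r) := by
          refine ENNReal.ofReal_le_ofReal ?_
          have : (1 - r)⁻¹ ≤ 2 := by
            rw [inv_le_comm₀ (by linarith) (by norm_num)]
            linarith
          nlinarith
  set BAD := notQ ∪ ⋃ i, ⋃ t, bad i t with hBAD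
  have hBADle : μ BAD ≤ ENNReal.ofReal (4 * Fintype.card ι * r) := by
    calc μ BAD ≤ μ notQ + μ (⋃ i, ⋃ t, bad i t) := measure_union_le _ _
      _ ≤ 0 + ∑ i, μ (⋃ t, bad i t) := by
          rw [hQ0]
          exact add_le_add le_rfl (measure_iUnion_fintype_le _ _)
      _ ≤ 0 + ∑ _i : ι, ENNReal.ofReal (4 * r) :=
          add_le_add le_rfl (Finset.sum_le_sum fun i _ => hunion i)
      _ = ENNReal.ofReal (4 * Fintype.card ι * r) := by
          rw [zero_add, Finset.sum_const, Finset.card_univ, nsmul_eq_mul,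
            ← ENNReal.ofReal_natCast, ← ENNReal.ofReal_mul (by positivity)]
          congr 1
          ring
  have hBADreal : μ.real BAD ≤ 4 * Fintype.card ι * r :=
    ENNReal.toReal_le_of_le_ofReal (by positivity) hBADle
  -- Covering the space and using subadditivity avoids any measurability of `S`.
  have hcov : (Set.univ : Set (ℕ × Fin B → Sample d n)) ⊆ S ∪ BAD := by
    intro ω _
    by_cases hb : ω ∈ BAD
    · exact Or.inr hb
    · left
      simp only [hBAD, Set.mem_union, Set.mem_iUnion, not_or, not_exists] at hb
      refine hS ω (not_not.1 hb.1) fun i t => ?_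
      exact not_lt.1 (hb.2 i t)
  have h1 : (1 : ℝ) ≤ μ.real S + μ.real BAD := by
    have := (measureReal_mono (μ := μ) hcov).trans (measureReal_union_le _ _)
    rwa [probReal_univ] at this
  linarith

end Concentration

/-! ### SGD in coordinates -/

section Coordinates

variable {d n m k B l : ℕ}

/-- The support condition of the data model: exactly one token is task-specific, and it carries the
label. -/
def IsTask (o : Bool → Fin d) (z : Sample d n) : Prop :=
  (∃! j, z.1 j = o z.2) ∧ ∀ j, z.1 j ≠ o (!z.2)

lemma sum_sq_inner {P : Fin d → Vec d} (hP : Orthonormal ℝ P) (v : Vec d) :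
    ∑ q, inner ℝ v (P q) ^ 2 = ‖v‖ ^ 2 := by
  rcases Nat.eq_zero_or_pos d with rfl | hd
  · simp [Subsingleton.elim v 0]
  have : Nonempty (Fin d) := ⟨⟨0, hd⟩⟩
  have hc : Fintype.card (Fin d) = Module.finrank ℝ (Vec d) := by simp
  let b := (basisOfOrthonormalOfCardEqFinrank hP hc).toOrthonormalBasis (by
    rw [coe_basisOfOrthonormalOfCardEqFinrank]; exact hP)
  have hb : ∀ q, b q = P q := fun q => by simp [b]
  have := b.sum_sq_norm_inner_left v
  simpa [hb] using this

lemma inner_batch_sum {P : Fin d → Vec d} (g : Fin B → Vec d) (η : ℝ) (v : Vec d) (q : Fin d) :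
    inner ℝ (v - η • ((B : ℝ)⁻¹ • ∑ b, g b)) (P q) =
      inner ℝ v (P q) + η * batchMean fun b => -inner ℝ (g b) (P q) := by
  simp only [inner_sub_left, inner_smul_left, sum_inner, conj_trivial, batchMean,
    Finset.sum_neg_distrib]
  ring

/-- SGD in the coordinates given by the patterns. -/
lemma isRun_sgd {P : Fin d → Vec d} (hP : Orthonormal ℝ P) {o : Bool → Fin d}
    (hl : 1 ≤ l) (hn : l ≤ n) (hB : 0 < B) {ηr ηe ε C : ℝ} (hr : 0 ≤ ηr) (he : 0 ≤ ηe)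
    (hε : 0 ≤ ε) (hC : 1 ≤ C) {a : Fin k → Bool} {θ₀ : Weights d m k}
    (hθ : ∀ s r, ‖θ₀.neuron s r‖ ≤ C - 1)
    {ω : ℕ × Fin B → Sample d n} (hω : ∀ i, IsTask o (ω i))
    (hfreq : ∀ q, (∀ b, q ≠ o b) → ∀ t, prefixCount (appears q) ω t ≤ ε * t) {H : ℕ}
    (hH : ηe * ε * H ≤ 1) (s : Fin k) :
    IsRun ηr ηe ε C H (o (a s)) (o (!a s))
      (fun t b q => gateMass l ((sgd P l a ηr ηe Finset.univ ω θ₀ t).router s) P (ω (t, b)) q)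
      (fun t b => sgn (ω (t, b)).2 * sgn (a s))
      (fun t q => inner ℝ ((sgd P l a ηr ηe Finset.univ ω θ₀ t).router s) (P q))
      (fun t r q => inner ℝ ((sgd P l a ηr ηe Finset.univ ω θ₀ t).neuron s r) (P q)) where
  batch_pos := hB
  ηr_nonneg := hr
  ηe_nonneg := he
  ε_nonneg := hε
  one_le := hC
  mass_nonneg _ _ q := gateMass_nonneg q
  mass_sum _ _ := sum_gateMass hl hn
  sign t b := by
    rcases eq_or_ne (ω (t, b)).2 (a s) with h | h
    · left
      refine ⟨by rw [h, sgn_mul_self], gateMass_eq_zero ?_⟩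
      rintro ⟨j, hj⟩
      exact (hω (t, b)).2 j (h ▸ hj)
    · right
      refine ⟨sgn_mul_of_ne h, gateMass_eq_zero ?_⟩
      rintro ⟨j, hj⟩
      have h' : (!(ω (t, b)).2) = a s := by
        cases h1 : (ω (t, b)).2 <;> cases h2 : a s <;> simp_all
      exact (hω (t, b)).2 j (h' ▸ hj)
  router t q := by
    simp only [sgd, sgdStep, Finset.mem_univ, if_true]
    rw [inner_batch_sum]
    simp only [inner_routerGrad hP hl hn, neg_neg, act]
  neuron t r q := by
    simp only [sgd, sgdStep, Finset.mem_univ, if_true]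
    rw [inner_batch_sum]
    simp only [inner_neuronGrad hP, neg_neg]
    split_ifs
    · rfl
    · simp [batchMean]
  init r q := by
    refine (abs_real_inner_le_norm _ _).trans ?_
    rw [hP.1 q, mul_one]
    exact hθ s r
  freq q hq hq' t := by
    refine le_trans (Finset.sum_le_sum fun τ _ => batchMean_mono fun b =>
      gateMass_le_indicator hl hn q) (hfreq q (fun b => ?_) t)
    cases hb : a s <;> cases b <;> simp_all
  horizon := hH

/-- One SGD step of an expert reads only its own weights, its head and the batch, so removing other
experts does not affect it. -/
lemma sgd_kept (P : Fin d → Vec d) (a : Fin k → Bool) (ηr ηe : ℝ) {R : Finset (Fin k)}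
    (ω : ℕ × Fin B → Sample d n) (θ₀ : Weights d m k) (T t : ℕ) {s : Fin k} (hs : s ∈ R) :
    (sgd P l a ηr ηe R (fun i => ω (T + i.1, i.2)) (sgd P l a ηr ηe Finset.univ ω θ₀ T) t).router s
        = (sgd P l a ηr ηe Finset.univ ω θ₀ (T + t)).router s ∧
      (sgd P l a ηr ηe R (fun i => ω (T + i.1, i.2)) (sgd P l a ηr ηe Finset.univ ω θ₀ T) t).neuron s
        = (sgd P l a ηr ηe Finset.univ ω θ₀ (T + t)).neuron s := by
  induction t with
  | zero => exact ⟨rfl, rfl⟩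
  | succ t ih =>
    rw [← add_assoc]
    simp only [sgd, sgdStep, hs, Finset.mem_univ, if_true, ih]
    exact ⟨trivial, trivial⟩

/-- A kept expert evolves as in the unpruned layer. -/
lemma prunedWeights_router (P : Fin d → Vec d) (a : Fin k → Bool) (ηr ηe : ℝ)
    {R : Finset (Fin k)} (ω : ℕ × Fin B → Sample d n) (θ₀ : Weights d m k) (T T' : ℕ) {s : Fin k}
    (hs : s ∈ R) : (prunedWeights P l a ηr ηe R ω θ₀ T T').router s =
      (sgd P l a ηr ηe Finset.univ ω θ₀ (T + T')).router s :=
  (sgd_kept P a ηr ηe ω θ₀ T T' hs).1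

lemma prunedWeights_neuron (P : Fin d → Vec d) (a : Fin k → Bool) (ηr ηe : ℝ)
    {R : Finset (Fin k)} (ω : ℕ × Fin B → Sample d n) (θ₀ : Weights d m k) (T T' : ℕ) {s : Fin k}
    (hs : s ∈ R) : (prunedWeights P l a ηr ηe R ω θ₀ T T').neuron s =
      (sgd P l a ηr ηe Finset.univ ω θ₀ (T + T')).neuron s :=
  (sgd_kept P a ηr ηe ω θ₀ T T' hs).2

/-- A router that moves little in all directions but one moves approximately on a line. -/
lemma norm_sub_le_of_coordinates {P : Fin d → Vec d} (hP : Orthonormal ℝ P) (e : Vec d)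
    {p p' : Fin d} {X Y : ℝ} (hX0 : 0 ≤ X) (hY0 : 0 ≤ Y)
    (hX : ∀ q, q ≠ p → q ≠ p' → |inner ℝ e (P q)| ≤ X) (hY : |inner ℝ e (P p')| ≤ Y) :
    ‖e - inner ℝ e (P p) • P p‖ ≤ √d * X + Y := by
  refine abs_le_of_sq_le_sq' ?_ (by positivity) |>.2
  rw [← sum_sq_inner hP]
  have hterm : ∀ q, inner ℝ (e - inner ℝ e (P p) • P p) (P q) ^ 2 ≤
      X ^ 2 + if q = p' then Y ^ 2 else 0 := by
    intro q
    rw [inner_sub_left, inner_smul_left, inner_pattern hP]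
    rcases eq_or_ne q p with rfl | hq
    · have : 0 ≤ X ^ 2 + if q = p' then Y ^ 2 else 0 := by positivity
      simpa using this
    · rw [if_neg hq.symm, mul_zero, sub_zero]
      rcases eq_or_ne q p' with rfl | hq'
      · rw [if_pos rfl]
        nlinarith [sq_le_sq' (abs_le.1 hY).1 (abs_le.1 hY).2]
      · rw [if_neg hq', add_zero]
        exact sq_le_sq' (abs_le.1 (hX q hq hq')).1 (abs_le.1 (hX q hq hq')).2
  refine (Finset.sum_le_sum fun q _ => hterm q).trans ?_
  rw [Finset.sum_add_distrib]
  simp only [Finset.sum_const, Finset.card_univ, Fintype.card_fin, nsmul_eq_mul,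
    Finset.sum_ite_eq', Finset.mem_univ, if_true]
  have := Real.sq_sqrt (Nat.cast_nonneg (α := ℝ) d)
  have h2 : 0 ≤ √(d : ℝ) * X * Y := by positivity
  nlinarith

/-! ### Gating values of the task-specific pattern -/

variable {P : Fin d → Vec d} {o : Bool → Fin d} {z : Sample d n} {w w' : Vec d}

lemma IsTask.exists_token (hz : IsTask o z) (l : ℕ) (w : Vec d) (P : Fin d → Vec d) :
    ∃ j, z.1 j = o z.2 ∧ (∀ i, i ≠ j → z.1 i ≠ o z.2 ∧ z.1 i ≠ o (!z.2)) ∧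
      gateMass l w P z (o z.2) = gate l w (tokens P z) j := by
  obtain ⟨⟨j, hj, hu⟩, hne⟩ := hz
  exact ⟨j, hj, fun i hi => ⟨fun h => hi (hu i h), hne i⟩, gateMass_eq_gate hj hu⟩

lemma IsTask.one_div_le_gateMass (hz : IsTask o z) (hl : 1 ≤ l) (hn : l ≤ n)
    (h : ∀ q, q ≠ o z.2 → inner ℝ w (P q) < inner ℝ w (P (o z.2))) :
    1 / (l : ℝ) ≤ gateMass l w P z (o z.2) := by
  obtain ⟨j, hj, hi, hg⟩ := hz.exists_token l w P
  rw [hg]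
  refine one_div_le_gate_of_forall_lt hl hn fun i hij => ?_
  simpa only [tokens, hj] using h _ (hi i hij).1

lemma IsTask.gateMass_le (hz : IsTask o z) (hl : 1 ≤ l) (hn : l ≤ n) {γ U V : ℝ}
    (hγ : γ * (Real.exp (U + V) + (l - 1)) ≤ l - 1) (hγ0 : 0 ≤ γ) (hγ1 : γ ≤ 1)
    (hU : inner ℝ w (P (o z.2)) ≤ U) (hV : ∀ q, q ≠ o z.2 → -V ≤ inner ℝ w (P q)) :
    gateMass l w P z (o z.2) ≤ 1 - γ := by
  obtain ⟨j, hj, hi, hg⟩ := hz.exists_token l w P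
  rw [hg]
  refine gate_le_of_bounds hn hγ hγ0 hγ1 hl ?_ fun i hij => ?_
  · simpa only [tokens, hj] using hU
  · exact hV _ (hi i hij).1

/-- The set of the samples of class `b` for which the router `w` is proficient. -/
def proficientSet (P : Fin d → Vec d) (l : ℕ) (o : Bool → Fin d) (b : Bool) (w : Vec d) :
    Set (Sample d n) :=
  labelled b ∩
    {z | ∃ j ∈ selected l w (tokens P z), z.1 j = o b ∧ 1 / (l : ℝ) ≤ gate l w (tokens P z) j}

lemma le_measureReal_proficientSet {D : Measure (Sample d n)} [IsProbabilityMeasure D]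
    {κ p₀ : ℝ} {b : Bool} (hp : 0 ≤ p₀) (hκ : κ ≤ D.real (labelled b))
    (h : p₀ ≤ proficiency P l o D b w) : κ * p₀ ≤ D.real (proficientSet P l o b w) := by
  have hm : MeasurableSet (labelled b : Set (Sample d n)) :=
    (Set.to_countable _).measurableSet
  unfold proficientSet
  unfold proficiency at h
  rw [Measure.real, cond_apply hm, ENNReal.toReal_mul, ENNReal.toReal_inv] at h
  refine (mul_le_mul_of_nonneg_right hκ hp).trans ?_
  rcases eq_or_ne (D.real (labelled b)) 0 with h0 | h0
  · rw [h0, zero_mul]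
    exact measureReal_nonneg
  · refine (mul_le_mul_of_nonneg_left h measureReal_nonneg).trans_eq ?_
    exact mul_inv_cancel_left₀ h0 _

/-- The other tokens of a sample of class `b` are all irrelevant patterns, so separation and margin
are needed only against those. The proficient set refers to the initial router `w` and so does not
depend on the batches. -/
lemma IsTask.gateMass_ge_of_perturbation (hz : IsTask o z) (hl : 1 ≤ l) (hn : l ≤ n) {σ : ℝ}
    {b : Bool} (hσ0 : 0 < σ) (hσ : σ ≤ Real.log 2) (hmem : z ∈ proficientSet P l o b w)
    (hsep : ∀ q, (∀ b', q ≠ o b') → σ ≤ |inner ℝ w (P (o b) - P q)|)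
    (hord : ∀ q, q ≠ o b → q ≠ o (!b) →
      -σ < (inner ℝ w' (P (o b)) - inner ℝ w (P (o b))) - (inner ℝ w' (P q) - inner ℝ w (P q))) :
    1 / (2 * l : ℝ) ≤ gateMass l w' P z (o b) := by
  obtain ⟨hb, j, hj, hjo, hg⟩ := hmem
  obtain rfl : z.2 = b := hb
  obtain ⟨j', hj', hi, hg'⟩ := hz.exists_token l w' P
  obtain rfl : j = j' := by
    by_contra hne
    exact (hi j hne).1 hjo
  rw [hg']
  refine (one_div_le_gate_of_perturbation hl hn hσ0 hσ hj hg (fun i hij => ?_)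
    fun i hij => ?_).2
  · have := hsep (z.1 i) fun b' => by
      have := hi i hij
      cases hz2 : z.2 <;> cases b' <;> simp_all
    simpa only [tokens, hj', inner_sub_right] using this
  · simpa only [tokens, hj'] using hord (z.1 i) (hi i hij).1 (hi i hij).2

end Coordinates

/-! ### Consequences for the routers -/

section Routers

variable {d n m k B l : ℕ}

lemma norm_sub_inner_smul_le {P : Fin d → Vec d} (hP : Orthonormal ℝ P) (v : Vec d) (p : Fin d) :
    ‖v - inner ℝ v (P p) • P p‖ ≤ ‖v‖ := by
  have h1 : ‖v - inner ℝ v (P p) • P p‖ ^ 2 = ‖v‖ ^ 2 - inner ℝ v (P p) ^ 2 := by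
    rw [norm_sub_sq_real, inner_smul_right, norm_smul, hP.1 p, mul_one, Real.norm_eq_abs, sq_abs]
    ring
  refine abs_le_of_sq_le_sq' ?_ (norm_nonneg v) |>.2
  rw [h1]
  linarith [sq_nonneg (inner ℝ v (P p))]

lemma IsRun.norm_router_sub_le {P : Fin d → Vec d} (hP : Orthonormal ℝ P) {ηr ηe ε C : ℝ} {H : ℕ}
    {p p' : Fin d} {π : ℕ → Fin B → Fin d → ℝ} {ς : ℕ → Fin B → ℝ} {w : ℕ → Vec d}
    {x : ℕ → Fin m → Fin d → ℝ}
    (h : IsRun ηr ηe ε C H p p' π ς (fun t q => inner ℝ (w t) (P q)) x) {δ : ℝ}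
    (hδ : √d * (ηr * (m * (C + ηe * H)) * (ε * H)) + ηr * (m * C) * H ≤ δ) {t : ℕ} (ht : t ≤ H) :
    ‖w t - w 0 - inner ℝ (w t - w 0) (P p) • P p‖ ≤ δ := by
  have hr := h.ηr_nonneg
  have he := h.ηe_nonneg
  have hε := h.ε_nonneg
  have hC : 0 ≤ C := zero_le_one.trans h.one_le
  have htH : (t : ℝ) ≤ H := by exact_mod_cast ht
  have hX0 : 0 ≤ ηr * (m * (C + ηe * H)) * (ε * H) := by positivity
  have hY0 : 0 ≤ ηr * (m * C) * H := by positivity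
  refine (norm_sub_le_of_coordinates hP _ (p' := p') hX0 hY0 (fun q hq hq' => ?_) ?_).trans hδ
  · rw [inner_sub_left]
    refine (h.abs_router_sub_le hq hq' ht).trans ?_
    gcongr
  · rw [inner_sub_left]
    refine (h.abs_router_other_sub_le ht).trans ?_
    gcongr

/-- A training run on batches with the typical frequencies, at learning rates and up to a horizon
`H` for which the routers move by at most `δ` except towards the task-specific pattern of their
class. -/
structure GoodRun (P : Fin d → Vec d) (o : Bool → Fin d) (l : ℕ) (a : Fin k → Bool)
    (ηr ηe ε C δ : ℝ) (θ₀ : Weights d m k) (ω : ℕ × Fin B → Sample d n) (H : ℕ) : Prop where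
  orthonormal : Orthonormal ℝ P
  ne : o true ≠ o false
  two_le : 2 ≤ l
  le_tokens : l ≤ n
  batch_pos : 0 < B
  ηr_nonneg : 0 ≤ ηr
  ηe_pos : 0 < ηe
  ε_nonneg : 0 ≤ ε
  one_le : 1 ≤ C
  neuron_le : ∀ s r, ‖θ₀.neuron s r‖ ≤ C - 1
  router_le : ∀ s, ‖θ₀.router s‖ ≤ 1 / 2 * Real.log l
  isTask : ∀ i, IsTask o (ω i)
  freq : ∀ q, (∀ b, q ≠ o b) → ∀ t, prefixCount (appears q) ω t ≤ ε * t
  horizon : ηe * ε * H ≤ 1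
  δ_le : δ ≤ Real.log 2 / 16
  drift : √d * (ηr * (m * (C + ηe * H)) * (ε * H)) + ηr * (m * C) * H ≤ δ

namespace GoodRun

variable {P : Fin d → Vec d} {o : Bool → Fin d} {a : Fin k → Bool}
  {ηr ηe ε C δ : ℝ} {θ₀ : Weights d m k} {ω : ℕ × Fin B → Sample d n} {H : ℕ}

lemma isRun (h : GoodRun P o l a ηr ηe ε C δ θ₀ ω H) (s : Fin k) :
    IsRun ηr ηe ε C H (o (a s)) (o (!a s))
      (fun t b q => gateMass l ((sgd P l a ηr ηe Finset.univ ω θ₀ t).router s) P (ω (t, b)) q)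
      (fun t b => sgn (ω (t, b)).2 * sgn (a s))
      (fun t q => inner ℝ ((sgd P l a ηr ηe Finset.univ ω θ₀ t).router s) (P q))
      (fun t r q => inner ℝ ((sgd P l a ηr ηe Finset.univ ω θ₀ t).neuron s r) (P q)) :=
  isRun_sgd h.orthonormal (one_le_two.trans h.two_le) h.le_tokens h.batch_pos h.ηr_nonneg
    h.ηe_pos.le h.ε_nonneg h.one_le h.neuron_le h.isTask h.freq h.horizon s

lemma log_two_le (h : GoodRun P o l a ηr ηe ε C δ θ₀ ω H) : Real.log 2 ≤ Real.log l :=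
  Real.log_le_log (by norm_num) (by exact_mod_cast h.two_le)

lemma δ_nonneg (h : GoodRun P o l a ηr ηe ε C δ θ₀ ω H) : 0 ≤ δ := by
  have hr := h.ηr_nonneg
  have he := h.ηe_pos
  have hε := h.ε_nonneg
  have hC : 0 ≤ C := zero_le_one.trans h.one_le
  exact le_trans (by positivity) h.drift

lemma norm_router_sub_le (h : GoodRun P o l a ηr ηe ε C δ θ₀ ω H) (s : Fin k) {t : ℕ}
    (ht : t ≤ H) :
    ‖(sgd P l a ηr ηe Finset.univ ω θ₀ t).router s - θ₀.router s -
      inner ℝ ((sgd P l a ηr ηe Finset.univ ω θ₀ t).router s - θ₀.router s) (P (o (a s))) •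
        P (o (a s))‖ ≤ δ :=
  (h.isRun s).norm_router_sub_le (w := fun t => (sgd P l a ηr ηe Finset.univ ω θ₀ t).router s)
    h.orthonormal h.drift ht

lemma abs_router_init_le (h : GoodRun P o l a ηr ηe ε C δ θ₀ ω H) (s : Fin k) (q : Fin d) :
    |inner ℝ (θ₀.router s) (P q)| ≤ 1 / 2 * Real.log l := by
  refine (abs_real_inner_le_norm _ _).trans ?_
  rw [h.orthonormal.1 q, mul_one]
  exact h.router_le s

lemma abs_router_le (h : GoodRun P o l a ηr ηe ε C δ θ₀ ω H) (s : Fin k) {t : ℕ}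
    (ht : t ≤ H) {q : Fin d} (hq : q ≠ o (a s)) :
    |inner ℝ ((sgd P l a ηr ηe Finset.univ ω θ₀ t).router s) (P q)| ≤ 1 / 2 * Real.log l + δ := by
  have h1 := abs_real_inner_le_norm ((sgd P l a ηr ηe Finset.univ ω θ₀ t).router s - θ₀.router s -
    inner ℝ ((sgd P l a ηr ηe Finset.univ ω θ₀ t).router s - θ₀.router s) (P (o (a s))) •
        P (o (a s))) (P q)
  rw [h.orthonormal.1 q, mul_one] at h1
  have h2 := h1.trans (h.norm_router_sub_le s ht)
  rw [inner_sub_left, inner_smul_left, inner_pattern h.orthonormal, if_neg hq.symm, mul_zero,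
    sub_zero, inner_sub_left] at h2
  have h3 := h.abs_router_init_le s q
  rw [abs_le] at h2 h3 ⊢
  constructor <;> linarith [h2.1, h2.2, h3.1, h3.2]

/-- The total possible loss along the own pattern is one of the terms of `drift`; hence what is
gained by time `T` survives the fine-tuning up to `δ`. -/
lemma router_sub_le_router (h : GoodRun P o l a ηr ηe ε C δ θ₀ ω H) (s : Fin k) {t t' : ℕ}
    (htt : t ≤ t') (ht : t' ≤ H) :
    inner ℝ ((sgd P l a ηr ηe Finset.univ ω θ₀ t).router s) (P (o (a s))) - δ ≤
      inner ℝ ((sgd P l a ηr ηe Finset.univ ω θ₀ t').router s) (P (o (a s))) := by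
  have h1 := (h.isRun s).router_sub_ge htt ht
  have hr := h.ηr_nonneg
  have he := h.ηe_pos
  have hε := h.ε_nonneg
  have hC : 0 ≤ C := zero_le_one.trans h.one_le
  have h2 : ηr * (m * C) * (t' - t : ℕ) ≤ ηr * (m * C) * H := by
    have : ((t' - t : ℕ) : ℝ) ≤ H := by exact_mod_cast (by omega : t' - t ≤ H)
    gcongr
  have h3 : 0 ≤ √d * (ηr * (m * (C + ηe * H)) * (ε * H)) := by positivity
  linarith [h.drift]

/-- A large norm change of the router reveals a large component along the task-specific pattern. -/
lemma router_ge_of_normChange (h : GoodRun P o l a ηr ηe ε C δ θ₀ ω H) {s : Fin k} {t : ℕ}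
    (ht : t ≤ H)
    (hs : Real.log l ≤ normChange θ₀ (sgd P l a ηr ηe Finset.univ ω θ₀ t) s) :
    Real.log l - δ ≤ inner ℝ ((sgd P l a ηr ηe Finset.univ ω θ₀ t).router s) (P (o (a s))) := by
  set w := (sgd P l a ηr ηe Finset.univ ω θ₀ t).router s with hw
  set w₀ := θ₀.router s with hw₀
  set p := P (o (a s)) with hp
  have hp1 : ‖p‖ = 1 := h.orthonormal.1 _
  have h1 : ‖w‖ ≤ |inner ℝ w p| + (‖w₀‖ + δ) := by
    -- Off the line spanned by `p`, the router is its initial part plus a drift of norm at most `δ`.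
    have e : w = inner ℝ w p • p + ((w₀ - inner ℝ w₀ p • p) +
        (w - w₀ - inner ℝ (w - w₀) p • p)) := by
      rw [inner_sub_left, sub_smul]
      abel
    calc ‖w‖ ≤ ‖inner ℝ w p • p‖ + (‖w₀ - inner ℝ w₀ p • p‖ +
          ‖w - w₀ - inner ℝ (w - w₀) p • p‖) := by
          conv_lhs => rw [e]
          exact (norm_add_le _ _).trans (add_le_add le_rfl (norm_add_le _ _))
      _ ≤ _ := by
          rw [norm_smul, hp1, mul_one, Real.norm_eq_abs]
          exact add_le_add le_rfl (add_le_add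
            (norm_sub_inner_smul_le h.orthonormal w₀ (o (a s))) (h.norm_router_sub_le s ht))
  have h2 : Real.log l ≤ ‖w‖ - ‖w₀‖ := hs
  have h3 := h.router_sub_le_router s (Nat.zero_le t) ht
  have h4 := (abs_le.1 (h.abs_router_init_le s (o (a s)))).1
  have h3' : inner ℝ w₀ p - δ ≤ inner ℝ w p := h3
  have h5 := h.log_two_le
  have h6 := h.δ_le
  have h7 : Real.log l - δ ≤ |inner ℝ w p| := by linarith
  have hl2 := Real.log_pos (show (1 : ℝ) < 2 by norm_num)
  rcases le_abs.1 h7 with h8 | h8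
  · exact h8
  -- A large negative component is impossible: it starts above `-(1 / 2) * log l` and loses at most
  -- `δ`.
  · exfalso
    linarith

/-- A router with a large component along the task-specific pattern always selects it. -/
lemma one_div_le_gateMass (h : GoodRun P o l a ηr ηe ε C δ θ₀ ω H) {s : Fin k} {t : ℕ}
    (ht : t ≤ H) {z : Sample d n} (hz : IsTask o z) (hzs : a s = z.2)
    (hU : Real.log l - 2 * δ ≤
      inner ℝ ((sgd P l a ηr ηe Finset.univ ω θ₀ t).router s) (P (o (a s)))) :
    1 / (l : ℝ) ≤ gateMass l ((sgd P l a ηr ηe Finset.univ ω θ₀ t).router s) P z (o z.2) := by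
  refine hz.one_div_le_gateMass (one_le_two.trans h.two_le) h.le_tokens fun q hq => ?_
  have h1 := (abs_le.1 (h.abs_router_le s ht (q := q) (hzs ▸ hq))).2
  have h5 := h.log_two_le
  have h6 := h.δ_le
  have hl2 := Real.log_pos (show (1 : ℝ) < 2 by norm_num)
  rw [← hzs]
  linarith

/-- The activation of an expert whose router has grown along the task-specific pattern. -/
lemma le_act_of_router_ge (h : GoodRun P o l a ηr ηe ε C δ θ₀ ω H) {s : Fin k} {t t' : ℕ}
    (htt : t ≤ t')
    (hU : Real.log l - δ ≤
      inner ℝ ((sgd P l a ηr ηe Finset.univ ω θ₀ t).router s) (P (o (a s)))) :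
    Real.log l / 4 ≤
      ηr * t * act ((sgd P l a ηr ηe Finset.univ ω θ₀ t').neuron s) (P (o (a s))) := by
  have h1 := (h.isRun s).router_sub_le t
  have h2 := (h.isRun s).monotone_sum_max htt
  have h3 := (abs_le.1 (h.abs_router_init_le s (o (a s)))).2
  have h4 := h.log_two_le
  have h5 := h.δ_le
  have hl2 := Real.log_pos (show (1 : ℝ) < 2 by norm_num)
  have h6 := mul_le_mul_of_nonneg_left h2 (mul_nonneg h.ηr_nonneg (Nat.cast_nonneg (α := ℝ) t))
  have h7 : inner ℝ ((sgd P l a ηr ηe Finset.univ ω θ₀ t).router s) (P (o (a s))) -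
      inner ℝ (θ₀.router s) (P (o (a s))) ≤ ηr * t *
      act ((sgd P l a ηr ηe Finset.univ ω θ₀ t').neuron s) (P (o (a s))) := h1.trans h6
  -- The component started at most at `1 / 2 * log l`, so it has gained at least `log l / 2 - δ`,
  -- which exceeds `log l / 4`.
  linarith

lemma act_le (h : GoodRun P o l a ηr ηe ε C δ θ₀ ω H) (s : Fin k) {t : ℕ} (ht : t ≤ H)
    {q : Fin d} (hq : q ≠ o (a s)) :
    act ((sgd P l a ηr ηe Finset.univ ω θ₀ t).neuron s) (P q) ≤ m * C :=
  (h.isRun s).sum_max_le ht hq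

lemma gateMass_le (h : GoodRun P o l a ηr ηe ε C δ θ₀ ω H) {s : Fin k} {t : ℕ}
    (ht : t ≤ H) {z : Sample d n} (hz : IsTask o z) (hzs : z.2 = a s) {γ U : ℝ}
    (hγ : γ * (Real.exp (U + (1 / 2 * Real.log l + δ)) + (l - 1)) ≤ l - 1) (hγ0 : 0 ≤ γ)
    (hγ1 : γ ≤ 1)
    (hU : inner ℝ ((sgd P l a ηr ηe Finset.univ ω θ₀ t).router s) (P (o (a s))) ≤ U) :
    gateMass l ((sgd P l a ηr ηe Finset.univ ω θ₀ t).router s) P z (o (a s)) ≤ 1 - γ := by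
  rw [← hzs] at hU ⊢
  refine hz.gateMass_le (one_le_two.trans h.two_le) h.le_tokens hγ hγ0 hγ1 hU fun q hq => ?_
  have := (abs_le.1 (h.abs_router_le s ht (q := q) (hzs ▸ hq))).1
  linarith

/-- An important expert: at the end of the training its router has a large component along the
task-specific pattern, and so do many of its neurons. -/
lemma important (h : GoodRun P o l a ηr ηe ε C δ θ₀ ω H) {s : Fin k}
    {pr a₀ φ α σ t₁ D γ : ℝ} {T : ℕ}
    (hsep : ∀ q, (∀ b', q ≠ o b') → σ ≤ |inner ℝ (θ₀.router s) (P (o (a s)) - P q)|)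
    (hact : φ * m ≤ ((Finset.univ.filter fun r =>
      0 ≤ inner ℝ (θ₀.neuron s r) (P (o (a s)))).card : ℝ))
    (hcount : ∀ t, |prefixCount (proficientSet P l o (a s) (θ₀.router s)) ω t - pr * t| ≤
      a₀ / 8 * t)
    (ha₀ : 0 < a₀) (hpr : a₀ ≤ pr) (hφ : 0 < φ) (hσ0 : 0 < σ) (hσ : σ ≤ Real.log 2)
    (hα : α = φ * a₀ / (4 * l)) (ht₁ : α * ηe * t₁ = 2 * C)
    (hD : ηr * H * (m * (C + ηe * H)) ≤ D)
    (hγ0 : 0 ≤ γ) (hγl : γ ≤ 1 / (2 * l))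
    (hγ : γ * (Real.exp (Real.log l + D + δ) + (l - 1)) ≤ l - 1)
    (hdrop : ηr * (m * C) * (t₁ + 1) ≤ σ / 4)
    (hdrift : ηr * (m * (C + ηe * (2 * t₁ + 2))) * (ε * (2 * t₁ + 2)) ≤ σ / 4)
    (hε : (1 + α) * ε ≤ γ * α * a₀ / 64)
    (hT₁ : 2 * t₁ + 2 ≤ T) (hTH : T ≤ H)
    (hgrow : 3 * Real.log l ≤ ηr * m * ηe * (1 / (5 * l) * α * a₀ / 64) * (T : ℝ) ^ 2) :
    3 / 2 * Real.log l ≤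
        inner ℝ ((sgd P l a ηr ηe Finset.univ ω θ₀ T).router s) (P (o (a s))) ∧
      m * α * ηe * T ≤
        act ((sgd P l a ηr ηe Finset.univ ω θ₀ T).neuron s) (P (o (a s))) := by
  have hl2 : (2 : ℝ) ≤ l := by exact_mod_cast h.two_le
  have hlog2 := Real.log_pos (show (1 : ℝ) < 2 by norm_num)
  have hlog := h.log_two_le
  have hδ := h.δ_le
  have hr := h.ηr_nonneg
  have he := h.ηe_pos
  have hC : 0 ≤ C := zero_le_one.trans h.one_le
  set χ : ℕ → Fin B → ℝ := fun t b =>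
    (proficientSet P l o (a s) (θ₀.router s)).indicator 1 (ω (t, b)) with hχ
  have hχmem : ∀ {t b}, χ t b = 1 →
      ω (t, b) ∈ proficientSet P l o (a s) (θ₀.router s) := by
    intro t b hb
    by_contra hne
    simp [hχ, hne] at hb
  have hrun : IsImportantRun ηr ηe ε C H (o (a s)) (o (!a s))
      (fun t b q => gateMass l ((sgd P l a ηr ηe Finset.univ ω θ₀ t).router s) P (ω (t, b)) q)
      (fun t b => sgn (ω (t, b)).2 * sgn (a s))
      (fun t q => inner ℝ ((sgd P l a ηr ηe Finset.univ ω θ₀ t).router s) (P q))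
      (fun t r q => inner ℝ ((sgd P l a ηr ηe Finset.univ ω θ₀ t).neuron s r) (P q))
      χ l pr a₀ φ α σ t₁ :=
    { h.isRun s with
      indicator := fun t b => by
        by_cases hb : ω (t, b) ∈ proficientSet P l o (a s) (θ₀.router s) <;> simp [hχ, hb]
      count := hcount
      l_pos := by linarith
      a₀_pos := ha₀
      a₀_le := hpr
      φ_pos := hφ
      active := hact
      mass_ge := fun t _ hm b hb =>
        (h.isTask (t, b)).gateMass_ge_of_perturbation (one_le_two.trans h.two_le) h.le_tokens
          hσ0 hσ (hχmem hb) hsep hm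
      α_eq := hα
      t₁_eq := ht₁
      ηe_pos := h.ηe_pos }
  -- An a priori bound on the router component over the whole horizon makes `γ` a valid, though very
  -- small, distance of the gate from saturation.
  have hinit : ∀ t, t ≤ H →
      inner ℝ ((sgd P l a ηr ηe Finset.univ ω θ₀ t).router s) (P (o (a s))) ≤
        1 / 2 * Real.log l + D := by
    intro t ht
    have h1 := (h.isRun s).router_sub_le t
    have h2 := (h.isRun s).sum_max_le_add ht (o (a s))
    have h3 := (abs_le.1 (h.abs_router_init_le s (o (a s)))).2
    have htH : (t : ℝ) ≤ H := by exact_mod_cast ht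
    have h4 : ηr * t * ∑ r, max (inner ℝ ((sgd P l a ηr ηe Finset.univ ω θ₀ t).neuron s r)
        (P (o (a s)))) 0 ≤ ηr * H * (m * (C + ηe * H)) := by
      refine (mul_le_mul_of_nonneg_left h2 (by positivity)).trans ?_
      gcongr
    have h5 : inner ℝ ((sgd P l a ηr ηe Finset.univ ω θ₀ t).router s) (P (o (a s))) -
      inner ℝ (θ₀.router s) (P (o (a s))) ≤ _ := h1.trans h4
    linarith
  have hγ1 : γ ≤ 1 := hγl.trans (by rw [div_le_one (by linarith)]; linarith)
  have hmargin : ∀ t ≤ H, KeepsMargin σ (o (a s)) (o (!a s))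
      (fun t q => inner ℝ ((sgd P l a ηr ηe Finset.univ ω θ₀ t).router s) (P q)) t := by
    intro t ht
    refine hrun.keepsMargin hσ0 hγ0 hγl (fun τ hτ b hb => ?_) hdrop hdrift hε ht
    refine h.gateMass_le hτ (h.isTask (τ, b)) (hχmem hb).1 ?_ hγ0 hγ1 (hinit τ hτ)
    convert hγ using 4
    ring
  have hord : ∀ τ < T, KeepsMargin σ (o (a s)) (o (!a s))
      (fun t q => inner ℝ ((sgd P l a ηr ηe Finset.univ ω θ₀ t).router s) (P q)) τ :=
    fun τ hτ => hmargin τ (by omega)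
  refine ⟨?_, hrun.sum_max_ge hTH hord⟩
  -- A second value of `γ` is used here, valid while the component is at most `3 / 2 * log l`.
  -- Unlike the first it does not depend on the upper constants of `T` and `T'`, so the lower
  -- constant of `T` can be fixed before them.
  refine hrun.router_ge hTH hord hT₁ (γ := 1 / (5 * l)) (by positivity) ?_
    (fun τ hτ hU b hb => ?_) ?_
  · exact one_div_le_one_div_of_le (by linarith) (by linarith)
  · refine h.gateMass_le hτ (h.isTask (τ, b)) (hχmem hb).1 ?_ (by positivity) ?_ hU
    · have hexp : Real.exp (3 / 2 * Real.log l + (1 / 2 * Real.log l + δ)) ≤ 2 * (l : ℝ) ^ 2 := by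
        have e : 2 * (l : ℝ) ^ 2 = Real.exp (Real.log 2 + (Real.log l + Real.log l)) := by
          rw [Real.exp_add, Real.exp_add, Real.exp_log (by norm_num), Real.exp_log (by linarith)]
          ring
        rw [e, Real.exp_le_exp]
        linarith
      rw [one_div, inv_mul_le_iff₀ (by positivity)]
      nlinarith
    · rw [div_le_one (by linarith)]
      linarith
  · have h3 := (abs_le.1 (h.abs_router_init_le s (o (a s)))).1
    have h4 : -(1 / 2 * Real.log l) ≤
        inner ℝ ((sgd P l a ηr ηe Finset.univ ω θ₀ 0).router s) (P (o (a s))) := h3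
    linarith

end GoodRun

end Routers

/-! ### Correctness of the pruned model -/

section Pruning

variable {d n m k B l : ℕ} {P : Fin d → Vec d} {o : Bool → Fin d} {a : Fin k → Bool}
  {ηr ηe ε C δ : ℝ} {θ₀ : Weights d m k} {ω : ℕ × Fin B → Sample d n}

lemma inter_headSet (a : Fin k → Bool) (b : Bool) (R : Finset (Fin k)) :
    R ∩ headSet a b = R.filter fun s => a s = b := by
  ext s
  simp [headSet]

/-- Experts with the correct head contribute nonnegatively on every pattern, so only the
task-specific one is retained. For an opposing expert the pattern on which it grew is absent from
`z`, so its averaged activation is at most `m * C`. -/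
lemma GoodRun.le_sgn_mul_output {T T' : ℕ} (h : GoodRun P o l a ηr ηe ε C δ θ₀ ω (T + T'))
    (R : Finset (Fin k)) {z : Sample d n} (hz : IsTask o z) :
    ∑ s ∈ R ∩ headSet a z.2,
        gateMass l ((sgd P l a ηr ηe Finset.univ ω θ₀ (T + T')).router s) P z (o z.2) *
          act ((sgd P l a ηr ηe Finset.univ ω θ₀ (T + T')).neuron s) (P (o z.2)) -
      (R ∩ headSet a (!z.2)).card * (m * C) ≤
    sgn z.2 * output l a R (prunedWeights P l a ηr ηe R ω θ₀ T T') (tokens P z) := by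
  have hl : 1 ≤ l := one_le_two.trans h.two_le
  rw [output_eq, Finset.mul_sum, inter_headSet, inter_headSet,
    ← Finset.sum_filter_add_sum_filter_not R fun s => a s = z.2, sub_eq_add_neg]
  refine add_le_add (Finset.sum_le_sum fun s hs => ?_) ?_
  · obtain ⟨hsR, hsz⟩ := Finset.mem_filter.1 hs
    rw [prunedWeights_router P a ηr ηe ω θ₀ T T' hsR, prunedWeights_neuron P a ηr ηe ω θ₀ T T' hsR,
      hsz, ← mul_assoc, sgn_mul_self, one_mul]
    exact Finset.single_le_sum (f := fun q =>
      gateMass l ((sgd P l a ηr ηe Finset.univ ω θ₀ (T + T')).router s) P z q *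
          act ((sgd P l a ηr ηe Finset.univ ω θ₀ (T + T')).neuron s) (P q))
      (fun q _ => mul_nonneg (gateMass_nonneg q) (act_nonneg _ _)) (Finset.mem_univ _)
  · have hset : (R.filter fun s => a s = !z.2) = R.filter fun s => ¬ a s = z.2 := by
      refine Finset.filter_congr fun s _ => ?_
      cases a s <;> cases z.2 <;> simp
    rw [hset, ← nsmul_eq_mul, ← smul_neg]
    refine Finset.card_nsmul_le_sum _ _ _ fun s hs => ?_
    obtain ⟨hsR, hsz⟩ := Finset.mem_filter.1 hs
    rw [prunedWeights_router P a ηr ηe ω θ₀ T T' hsR, prunedWeights_neuron P a ηr ηe ω θ₀ T T' hsR,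
      ← mul_assoc, sgn_mul_of_ne (Ne.symm hsz), neg_one_mul, neg_le_neg_iff]
    have hterm : ∀ q, gateMass l ((sgd P l a ηr ηe Finset.univ ω θ₀ (T + T')).router s) P z q *
        act ((sgd P l a ηr ηe Finset.univ ω θ₀ (T + T')).neuron s) (P q) ≤
        gateMass l ((sgd P l a ηr ηe Finset.univ ω θ₀ (T + T')).router s) P z q * (m * C) := by
      intro q
      by_cases hq : q = o (a s)
      · rw [gateMass_eq_zero, zero_mul, zero_mul]
        rintro ⟨j, hj⟩
        have hne : (!z.2) = a s := by
          cases h1 : a s <;> cases h2 : z.2 <;> simp_all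
        exact hz.2 j (by rw [hj, hq, hne])
      · exact mul_le_mul_of_nonneg_left (h.act_le s le_rfl hq) (gateMass_nonneg q)
    refine (Finset.sum_le_sum fun q _ => hterm q).trans_eq ?_
    rw [← Finset.sum_mul, sum_gateMass hl h.le_tokens, one_mul]

/-- The pruned model classifies every sample correctly, if for each class there is an expert with a
large router and a large activation, and if all experts with large routers have a sufficiently
large activation. -/
lemma GoodRun.output_pos {T T' : ℕ} (h : GoodRun P o l a ηr ηe ε C δ θ₀ ω (T + T'))
    {X Y ρ β : ℝ}
    (himp : ∀ b, ∃ s, a s = b ∧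
      3 / 2 * Real.log l ≤
        inner ℝ ((sgd P l a ηr ηe Finset.univ ω θ₀ T).router s) (P (o (a s))) ∧
      X ≤ act ((sgd P l a ηr ηe Finset.univ ω θ₀ T).neuron s) (P (o (a s))))
    (hX : k * (m * C) < 1 / l * X) (hX0 : 0 ≤ X) (hY0 : 0 ≤ Y)
    (hY : ηr * T * Y ≤ Real.log l / 4) (hβY : 2 * (m * C) < β / 2 * (1 / l * Y))
    (hβ : ∀ b, β * (k : ℝ) ≤ ((headSet a b).card : ℝ))
    (hρ1 : 1 ≤ (1 - ρ) * k) (hρβ : 2 ≤ (1 - ρ) * (β * k))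
    {R : Finset (Fin k)}
    (hR : IsKept a ρ (normChange θ₀ (sgd P l a ηr ηe Finset.univ ω θ₀ T)) R)
    {z : Sample d n} (hz : IsTask o z) :
    0 < sgn z.2 * output l a R (prunedWeights P l a ηr ηe R ω θ₀ T T') (tokens P z) := by
  refine lt_of_lt_of_le ?_ (h.le_sgn_mul_output R hz)
  have hl0 : (0 : ℝ) ≤ 1 / l := by positivity
  have hC : 0 ≤ m * C := mul_nonneg (Nat.cast_nonneg _) (zero_le_one.trans h.one_le)
  have hlog2 := Real.log_pos (show (1 : ℝ) < 2 by norm_num)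
  have hlog := h.log_two_le
  have hδ := h.δ_le
  obtain ⟨s, hsz, hU, hA⟩ := himp z.2
  have hnn : ∀ s' ∈ R ∩ headSet a z.2, 0 ≤
      gateMass l ((sgd P l a ηr ηe Finset.univ ω θ₀ (T + T')).router s') P z (o z.2) *
          act ((sgd P l a ηr ηe Finset.univ ω θ₀ (T + T')).neuron s') (P (o z.2)) :=
    fun s' _ => mul_nonneg (gateMass_nonneg _) (act_nonneg _ _)
  -- If the important expert is kept, it alone beats all opposing experts; otherwise all kept
  -- experts of its sign inherit its norm growth.
  by_cases hsR : s ∈ R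
  · have hmem : s ∈ R ∩ headSet a z.2 := by
      rw [inter_headSet]; exact Finset.mem_filter.2 ⟨hsR, hsz⟩
    have h1 := Finset.single_le_sum hnn hmem
    have h2 := h.one_div_le_gateMass le_rfl hz hsz (by
      linarith [h.router_sub_le_router s (Nat.le_add_right T T') le_rfl, h.δ_nonneg])
    have h3 : X ≤ act ((sgd P l a ηr ηe Finset.univ ω θ₀ (T + T')).neuron s) (P (o z.2)) := by
      rw [← hsz]
      exact hA.trans ((h.isRun s).monotone_sum_max (Nat.le_add_right T T'))
    have h4 := mul_le_mul h2 h3 hX0 (gateMass_nonneg _)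
    have h5 : ((R ∩ headSet a (!z.2)).card : ℝ) ≤ k := by
      have := Finset.card_le_univ (R ∩ headSet a (!z.2))
      rw [Fintype.card_fin] at this
      exact_mod_cast this
    have h6 := mul_le_mul_of_nonneg_right h5 hC
    linarith
  · have hterm : ∀ s' ∈ R ∩ headSet a z.2, 1 / l * Y ≤
        gateMass l ((sgd P l a ηr ηe Finset.univ ω θ₀ (T + T')).router s') P z (o z.2) *
          act ((sgd P l a ηr ηe Finset.univ ω θ₀ (T + T')).neuron s') (P (o z.2)) := by
      intro s' hs'
      rw [inter_headSet] at hs'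
      obtain ⟨hs'R, hs'z⟩ := Finset.mem_filter.1 hs'
      have hmem : ∀ {s}, a s = z.2 → s ∈ headSet a z.2 := fun hs =>
        Finset.mem_filter.2 ⟨Finset.mem_univ _, hs⟩
      have h1 := (hR z.2).2.2 s' (hmem hs'z) s (hmem hsz) hs'R hsR
      -- The final norm is at least the component `3 / 2 * log l`, and the initial norm is at most
      -- `1 / 2 * log l`.
      have h2 : Real.log l ≤ normChange θ₀ (sgd P l a ηr ηe Finset.univ ω θ₀ T) s := by
        have h3 := real_inner_le_norm ((sgd P l a ηr ηe Finset.univ ω θ₀ T).router s)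
          (P (o (a s)))
        rw [h.orthonormal.1, mul_one] at h3
        have h4 := h.router_le s
        unfold normChange
        linarith
      have h3 := h.router_ge_of_normChange (Nat.le_add_right T T') (h2.trans h1)
      have h4 := h.one_div_le_gateMass le_rfl hz hs'z (by
        linarith [h.router_sub_le_router s' (Nat.le_add_right T T') le_rfl])
      have h5 := h.le_act_of_router_ge (Nat.le_add_right T T') h3
      have hpos : 0 < ηr * T := by
        have h0 : 0 ≤ ηr * T := mul_nonneg h.ηr_nonneg (Nat.cast_nonneg _)
        rcases h0.eq_or_lt with h0 | h0
        · rw [← h0, zero_mul] at h5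
          linarith
        · exact h0
      have h6 := le_of_mul_le_mul_left (hY.trans h5) hpos
      rw [hs'z] at h6
      exact mul_le_mul h4 h6 hY0 (gateMass_nonneg _)
    have h1 := Finset.card_nsmul_le_sum _ _ _ hterm
    rw [nsmul_eq_mul] at h1
    have hρ : 0 ≤ 1 - ρ := by
      by_contra! hneg
      nlinarith [Nat.cast_nonneg (α := ℝ) k]
    -- Rounding down costs less than one expert, at most half of the bound by `hρβ`; below, rounding
    -- up at most doubles the bound, by `hρ1`.
    have h2 : (1 - ρ) * k * (β / 2) ≤ ((R ∩ headSet a z.2).card : ℝ) := by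
      have h3 : ((⌊(1 - ρ) * ((headSet a z.2).card : ℝ)⌋₊ : ℕ) : ℝ) ≤
          ((R ∩ headSet a z.2).card : ℝ) := by exact_mod_cast (hR z.2).1
      have h4 := Nat.sub_one_lt_floor ((1 - ρ) * ((headSet a z.2).card : ℝ))
      have h5 := mul_le_mul_of_nonneg_left (hβ z.2) hρ
      linarith
    have h3 : ((R ∩ headSet a (!z.2)).card : ℝ) ≤ 2 * ((1 - ρ) * k) := by
      have h3 : ((R ∩ headSet a (!z.2)).card : ℝ) ≤
        ((⌈(1 - ρ) * ((headSet a (!z.2)).card : ℝ)⌉₊ : ℕ) : ℝ) := by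
          exact_mod_cast (hR (!z.2)).2.1
      have h4 := Nat.ceil_lt_add_one (mul_nonneg hρ
        (Nat.cast_nonneg (α := ℝ) (headSet a (!z.2)).card))
      have h5 : ((headSet a (!z.2)).card : ℝ) ≤ k := by
        have := Finset.card_le_univ (headSet a (!z.2))
        rw [Fintype.card_fin] at this
        exact_mod_cast this
      have h6 := mul_le_mul_of_nonneg_left h5 hρ
      linarith
    have h4 := mul_le_mul_of_nonneg_right h2 (mul_nonneg hl0 hY0)
    have h5 := mul_le_mul_of_nonneg_right h3 hC
    have h6 := mul_lt_mul_of_pos_left hβY (lt_of_lt_of_le one_pos hρ1)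
    linarith

end Pruning

/-! ### Estimates for the constants -/

section Constants

open Filter Topology

lemma eventually_mul_le_nhdsGT (c : ℝ) {r : ℝ} (hr : 0 < r) : ∀ᶠ η in 𝓝[>] (0 : ℝ), c * η ≤ r := by
  have h : Tendsto (fun η : ℝ => c * η) (𝓝 0) (𝓝 (c * 0)) := tendsto_id.const_mul c
  rw [mul_zero] at h
  exact (h.mono_left nhdsWithin_le_nhds).eventually (ge_mem_nhds hr)

lemma eventually_le_sqrt (c : ℝ) : ∀ᶠ d : ℕ in atTop, c ≤ √(d : ℝ) :=
  (Real.tendsto_sqrt_atTop.comp tendsto_natCast_atTop_atTop).eventually_ge_atTop c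

lemma eventually_mul_exp_le (N : ℕ) {c : ℝ} (hc : 0 < c) :
    ∀ᶠ d : ℕ in atTop, 4 * (d + 2 : ℝ) * Real.exp (-(c * d)) ≤ 1 / (d : ℝ) ^ N ∧
      Real.exp (-(c * d)) ≤ 1 / 2 := by
  have h1 : Tendsto (fun d : ℕ => c * (d : ℝ)) atTop atTop :=
    tendsto_natCast_atTop_atTop.const_mul_atTop hc
  have h2 := ((Real.tendsto_pow_mul_exp_neg_atTop_nhds_zero (N + 1)).comp h1).eventually
    (ge_mem_nhds (show (0 : ℝ) < c ^ (N + 1) / 12 by positivity))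
  have h3 := (Real.tendsto_exp_neg_atTop_nhds_zero.comp h1).eventually
    (ge_mem_nhds (show (0 : ℝ) < 1 / 2 by norm_num))
  filter_upwards [h2, h3, eventually_ge_atTop 1] with d hd hd' hd1
  refine ⟨?_, hd'⟩
  have hd0 : (1 : ℝ) ≤ d := by exact_mod_cast hd1
  simp only [Function.comp_apply, mul_pow] at hd
  rw [le_div_iff₀ (by positivity)]
  have h5 : (d : ℝ) ^ (N + 1) * Real.exp (-(c * d)) ≤ 1 / 12 := by
    have : c ^ (N + 1) * ((d : ℝ) ^ (N + 1) * Real.exp (-(c * d))) ≤ c ^ (N + 1) * (1 / 12) := by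
      rw [← mul_assoc]
      linarith
    exact le_of_mul_le_mul_left this (by positivity)
  calc 4 * (d + 2 : ℝ) * Real.exp (-(c * d)) * d ^ N
      ≤ 4 * (3 * d) * Real.exp (-(c * d)) * d ^ N := by gcongr; linarith
    _ = 12 * (d ^ (N + 1) * Real.exp (-(c * d))) := by ring
    _ ≤ 1 := by linarith

-- Here `x` stands for `√d` and `y` for `√(log l)`, while `M * x` bounds `ηe * H` and `q / x` bounds
-- `ηr * m * H`, for a number `H` of steps.
variable {m l x H q M C η δ ηr ηe cr cr' a₀ φ α t₁ E κ₁ y T cp CT Kk k d : ℝ}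

/-- With frequency `η / x`, the factor `x = √d` from the number of coordinates cancels, and the
irrelevant drift is small through `η`; the drift along `p'` is of order `1 / x`. -/
lemma drift_le (hx : 0 < x) (hC : 0 ≤ C) (hη : 0 ≤ η) (hM : 0 ≤ M) (hmH : 0 ≤ ηr * m * H)
    (hδ : 0 < δ)
    (hq : ηr * m * H * x ≤ q) (hH : ηe * H ≤ M * x) (hx1 : 1 ≤ x)
    (h1 : q * (C + M) * η ≤ δ / 2) (h2 : 2 * q * C / δ ≤ x) :
    x * (ηr * (m * (C + ηe * H)) * (η / x * H)) + ηr * (m * C) * H ≤ δ := by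
  have e1 : x * (ηr * (m * (C + ηe * H)) * (η / x * H)) = ηr * m * H * (C + ηe * H) * η := by
    field_simp
  have e2 : ηr * m * H * (C + ηe * H) * η ≤ ηr * m * H * ((C + M) * x) * η := by
    gcongr
    nlinarith
  have e3 : ηr * m * H * ((C + M) * x) * η ≤ q * (C + M) * η := by
    calc _ = (ηr * m * H * x) * (C + M) * η := by ring
      _ ≤ _ := by gcongr
  have e4 : ηr * (m * C) * H ≤ δ / 2 := by
    rw [div_le_iff₀ hδ] at h2
    have : ηr * (m * C) * H * x ≤ δ / 2 * x := by
      calc ηr * (m * C) * H * x = (ηr * m * H * x) * C := by ring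
        _ ≤ q * C := by gcongr
        _ ≤ δ / 2 * x := by linarith
    exact le_of_mul_le_mul_right this hx
  linarith

lemma router_range_le (hC : 0 ≤ C) (hM : 0 ≤ M) (hmH : 0 ≤ ηr * m * H)
    (hq : ηr * m * H * x ≤ q) (hH : ηe * H ≤ M * x) (hx1 : 1 ≤ x) :
    ηr * H * (m * (C + ηe * H)) ≤ q * (C + M) := by
  have hCM := add_nonneg hC hM
  calc ηr * H * (m * (C + ηe * H)) = ηr * m * H * (C + ηe * H) := by ring
    _ ≤ ηr * m * H * ((C + M) * x) := by gcongr; nlinarith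
    _ = (ηr * m * H * x) * (C + M) := by ring
    _ ≤ _ := by gcongr

lemma rate_mul_le (hx : 0 < x) (hl : 1 ≤ l) (hcr : 0 ≤ cr) (hH0 : 0 ≤ H)
    (hr : ηr * m * (x ^ 2 * l ^ 2) ≤ cr * ηe) (hH : ηe * H ≤ M * x) (hrm : 0 ≤ ηr * m) :
    ηr * m * H * x ≤ cr * M := by
  have h1 : ηr * m * H * x * x ≤ cr * M * x := by
    calc ηr * m * H * x * x = ηr * m * (x ^ 2 * 1) * H := by ring
      _ ≤ ηr * m * (x ^ 2 * l ^ 2) * H := by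
          gcongr
          nlinarith
      _ ≤ cr * ηe * H := by gcongr
      _ = cr * (ηe * H) := by ring
      _ ≤ cr * (M * x) := by gcongr
      _ = _ := by ring
  exact le_of_mul_le_mul_right h1 hx

/-- This estimate dictates `cr`: before domination, which takes of order `l / ηe` steps, the router
may lose only a quarter of the separation `cp / d`. The term `|E|` pays for the rounding step. -/
lemma drop_le (hd : 0 < d) (hl : 1 ≤ l) (hC : 0 < C) (hφ : 0 < φ) (ha : 0 < a₀) (hcp : 0 < cp)
    (hcr : cr = cp / (4 * (C * (8 * C / (φ * a₀) + |E|)))) (hα : α = φ * a₀ / (4 * l))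
    (ht₁ : α * ηe * t₁ = 2 * C) (he : 0 < ηe) (hE : ηe ≤ |E|)
    (hr : ηr * m * (d * l ^ 2) ≤ cr * ηe) :
    ηr * (m * C) * (t₁ + 1) ≤ cp / d / 4 := by
  have hl0 : 0 < l := by linarith
  have hE0 : 0 < |E| := lt_of_lt_of_le he hE
  have hα0 : 0 < α := by rw [hα]; positivity
  have h1 : ηe * t₁ = 8 * C / (φ * a₀) * l := by
    have : ηe * t₁ = 2 * C / α := by
      rw [eq_div_iff hα0.ne', ← ht₁]; ring
    rw [this, hα]
    field_simp
    ring
  have ht0 : 0 < t₁ := by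
    have : 0 < ηe * t₁ := by rw [h1]; positivity
    exact pos_of_mul_pos_right this he.le
  have hcr0 : 0 < cr := by rw [hcr]; positivity
  have h2 : ηr * (m * C) * (t₁ + 1) * d * l ^ 2 ≤ cp / 4 * l ^ 2 := by
    calc ηr * (m * C) * (t₁ + 1) * d * l ^ 2 = (ηr * m * (d * l ^ 2)) * (C * (t₁ + 1)) := by ring
      _ ≤ (cr * ηe) * (C * (t₁ + 1)) := by gcongr
      _ = cr * (C * (ηe * t₁ + ηe)) := by ring
      _ ≤ cr * (C * (8 * C / (φ * a₀) * l + |E| * l)) := by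
          rw [h1]
          gcongr
          nlinarith
      _ = cr * (C * (8 * C / (φ * a₀) + |E|)) * l := by ring
      _ = cp / 4 * l := by
          rw [hcr]
          have : C * (8 * C / (φ * a₀) + |E|) ≠ 0 := by positivity
          field_simp
      _ ≤ cp / 4 * l ^ 2 := by
          gcongr
          nlinarith
  have h3 := le_of_mul_le_mul_right h2 (by positivity)
  rw [div_div, le_div_iff₀ (by positivity)]
  linarith

lemma early_drift_le (hd : 0 < d) (hx : 1 ≤ x) (hl : 1 ≤ l) (hC : 0 ≤ C) (hη : 0 ≤ η)
    (hcr : 0 ≤ cr) (ht₁ : 0 ≤ t₁) (he : 0 < ηe) (hκ : ηe * (2 * t₁ + 2) ≤ κ₁) (hrm : 0 ≤ ηr * m)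
    (hr : ηr * m * (d * l ^ 2) ≤ cr * ηe) (hsmall : cr * κ₁ * (C + κ₁) * η ≤ cp / 4) :
    ηr * (m * (C + ηe * (2 * t₁ + 2))) * (η / x * (2 * t₁ + 2)) ≤ cp / d / 4 := by
  have hr' : ηr * m * d ≤ cr * ηe := by
    refine le_trans ?_ hr
    calc ηr * m * d = ηr * m * (d * 1) := by ring
      _ ≤ _ := by gcongr; nlinarith
  have hηx : η / x ≤ η := div_le_self hη hx
  have hκ0 : 0 ≤ κ₁ := le_trans (by positivity) hκ
  rw [div_div, le_div_iff₀ (by positivity)]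
  have : ηr * (m * (C + ηe * (2 * t₁ + 2))) * (η / x * (2 * t₁ + 2)) * d ≤
      cr * κ₁ * (C + κ₁) * η := by
    calc _ = (ηr * m * d) * (C + ηe * (2 * t₁ + 2)) * (2 * t₁ + 2) * (η / x) := by ring
      _ ≤ (cr * ηe) * (C + κ₁) * (2 * t₁ + 2) * η := by gcongr
      _ = cr * (ηe * (2 * t₁ + 2)) * (C + κ₁) * η := by ring
      _ ≤ _ := by gcongr
  linarith

/-- The constant `3840` is `3 * 5 * 4 * 64`, collected from the target `3 * log l`, the gate slack
`1 / (5 * l)`, the definition of `α` and the quadratic growth. -/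
lemma growth_le (hl : 0 < l) (hx : 0 < x) (hy : 0 ≤ y) (hcr' : 0 < cr') (hφ : 0 < φ)
    (ha : 0 < a₀) (hCT0 : 0 ≤ CT) (hα : α = φ * a₀ / (4 * l)) (he : 0 < ηe)
    (hCT : 3840 / (cr' * φ * a₀ ^ 2) ≤ CT ^ 2)
    (hr : cr' * ηe ≤ ηr * m * (x ^ 2 * l ^ 2))
    (hT : CT * (l ^ 2 * (x * y)) ≤ ηe * T) :
    3 * y ^ 2 ≤ ηr * m * ηe * (1 / (5 * l) * α * a₀ / 64) * T ^ 2 := by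
  have hT2 : (CT * (l ^ 2 * (x * y))) ^ 2 ≤ (ηe * T) ^ 2 :=
    pow_le_pow_left₀ (by positivity) hT 2
  rw [div_le_iff₀ (by positivity)] at hCT
  have h1 : cr' * CT ^ 2 * l ^ 2 * y ^ 2 ≤ ηr * m * ηe * T ^ 2 := by
    have : cr' * CT ^ 2 * l ^ 2 * y ^ 2 * (x ^ 2 * l ^ 2 * ηe) ≤
        ηr * m * ηe * T ^ 2 * (x ^ 2 * l ^ 2 * ηe) := by
      calc _ = (cr' * ηe) * (CT * (l ^ 2 * (x * y))) ^ 2 := by ring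
        _ ≤ (cr' * ηe) * (ηe * T) ^ 2 := by gcongr
        _ ≤ (ηr * m * (x ^ 2 * l ^ 2)) * (ηe * T) ^ 2 := by gcongr
        _ = _ := by ring
    exact le_of_mul_le_mul_right this (by positivity)
  calc 3 * y ^ 2 = 3840 * (y ^ 2 / 1280) := by ring
    _ ≤ CT ^ 2 * (cr' * φ * a₀ ^ 2) * (y ^ 2 / 1280) := by gcongr
    _ = (cr' * CT ^ 2 * l ^ 2 * y ^ 2) * (φ * a₀ ^ 2 / (1280 * l ^ 2)) := by
        field_simp
    _ ≤ (ηr * m * ηe * T ^ 2) * (φ * a₀ ^ 2 / (1280 * l ^ 2)) := by gcongr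
    _ = _ := by
        rw [hα]
        field_simp
        ring

lemma harm_lt (hl : 0 < l) (hx : 0 < x) (hy : 1 / 2 ≤ y) (hφ : 0 < φ) (hm : 0 < m)
    (ha : 0 < a₀) (hC : 0 < C) (hα : α = φ * a₀ / (4 * l))
    (hCT : 8 * (|Kk| + 1) * C / (φ * a₀) ≤ CT)
    (hk : k ≤ Kk * x) (hT : CT * (l ^ 2 * (x * y)) ≤ ηe * T) :
    k * (m * C) < 1 / l * (m * α * ηe * T) := by
  rw [div_le_iff₀ (by positivity)] at hCT
  have hk' : k < (|Kk| + 1) * x := by nlinarith [le_abs_self Kk]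
  calc k * (m * C) < (|Kk| + 1) * x * (m * C) := by gcongr
    _ = 8 * (|Kk| + 1) * C * (m * x / 8) := by ring
    _ ≤ CT * (φ * a₀) * (m * x / 8) := by gcongr
    _ = CT * (φ * a₀) * m * x * (1 / 2) / 4 := by ring
    _ ≤ CT * (φ * a₀) * m * x * y / 4 := by
        have : 0 ≤ CT * (φ * a₀) := le_trans (by positivity) hCT
        gcongr
    _ = CT * (l ^ 2 * (x * y)) * (m * φ * a₀ / (4 * l ^ 2)) := by field_simp
    _ ≤ ηe * T * (m * φ * a₀ / (4 * l ^ 2)) := by gcongr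
    _ = _ := by
        rw [hα]
        field_simp

lemma frequency_le {K : ℝ} (hη : 0 < η) (hx : 0 < x) (h : 2 * K / η ≤ x) :
    K / x ^ 2 ≤ η / (2 * x) := by
  rw [div_le_iff₀ hη] at h
  rw [div_le_div_iff₀ (by positivity) (by positivity)]
  nlinarith

lemma separation_le {c : ℝ} (hc : 0 < c) (hx : 1 ≤ x) (h : cp / c ≤ x) : cp / x ^ 2 ≤ c := by
  rw [div_le_iff₀ hc] at h
  rw [div_le_iff₀ (by positivity)]
  nlinarith [mul_le_mul_of_nonneg_left hx (mul_pos hc (zero_lt_one.trans_le hx)).le]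

lemma exp_batch_le {B : ℝ} (hx : 0 < x) (hl : 1 ≤ l) (hB : l ^ 2 * (x ^ 2) ^ 2 ≤ B) :
    Real.exp (-2 * (η / (2 * x)) ^ 2 * B) ≤ Real.exp (-(η ^ 2 / 2 * x ^ 2)) := by
  rw [Real.exp_le_exp]
  have h1 : (x ^ 2) ^ 2 ≤ B := by
    refine le_trans ?_ hB
    have : (1 : ℝ) ≤ l ^ 2 := one_le_pow₀ hl
    nlinarith [sq_nonneg (x ^ 2)]
  have h2 : η ^ 2 / (2 * x ^ 2) * (x ^ 2) ^ 2 ≤ η ^ 2 / (2 * x ^ 2) * B := by gcongr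
  have h3 : η ^ 2 / (2 * x ^ 2) * (x ^ 2) ^ 2 = η ^ 2 / 2 * x ^ 2 := by field_simp
  have h4 : -2 * (η / (2 * x)) ^ 2 * B = -(η ^ 2 / (2 * x ^ 2) * B) := by field_simp
  linarith

lemma rate_mul_activation_le (hq : 0 < q) (h : ηr * m * T * x ≤ q) :
    ηr * T * (m * x * y ^ 2 / (4 * q)) ≤ y ^ 2 / 4 := by
  calc ηr * T * (m * x * y ^ 2 / (4 * q)) = (ηr * m * T * x) * (y ^ 2 / (4 * q)) := by ring
    _ ≤ q * (y ^ 2 / (4 * q)) := by gcongr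
    _ = y ^ 2 / 4 := by field_simp

lemma harm_lt_activation {β AT : ℝ} (hm : 0 < m) (hl : 0 < l) (hy : 0 < y) (hβ : 0 < β)
    (hcr : 0 < cr) (hAT : 0 < AT) (h : 16 * C * cr * AT * l ^ 3 / (β * y) + 1 ≤ x) :
    2 * (m * C) < β / 2 * (1 / l * (m * x * y ^ 2 / (4 * (cr * (AT * (l ^ 2 * y)))))) := by
  have h1 : 16 * C * cr * AT * l ^ 3 < x * (β * y) := by
    rw [← div_lt_iff₀ (by positivity)]
    linarith
  have h2 : β / 2 * (1 / l * (m * x * y ^ 2 / (4 * (cr * (AT * (l ^ 2 * y)))))) =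
      x * (β * y) * (m / (8 * cr * AT * l ^ 3)) := by
    field_simp
    ring
  have h3 : 2 * (m * C) = 16 * C * cr * AT * l ^ 3 * (m / (8 * cr * AT * l ^ 3)) := by
    field_simp
    ring
  rw [h2, h3]
  gcongr

lemma gate_slack {e : ℝ} (hl : 2 ≤ l) (he : 0 < e) :
    1 / (2 * l * (e + l)) ≤ 1 / (2 * l) ∧ 1 / (2 * l * (e + l)) * (e + (l - 1)) ≤ l - 1 := by
  constructor
  · exact one_div_le_one_div_of_le (by positivity)
      (le_mul_of_one_le_right (by positivity) (by linarith))
  · rw [one_div, inv_mul_le_iff₀ (by positivity)]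
    have h1 : (1 : ℝ) ≤ 2 * l * (l - 1) := by nlinarith
    have h2 : 0 < e + l := by positivity
    nlinarith

end Constants

end MoE

end

/-! ### The main theorem: choice of the constants and assembly. -/

set_option maxHeartbeats 1000000 in
open MoE Filter Topology in
theorem theorem2
    (κ K p₀ cp φ C₂ E Kk β : ℝ)
    (hκ : 0 < κ) (hp₀ : 0 < p₀) (hcp : 0 < cp) (hφ : 0 < φ) (hβ : 0 < β) :
    ∃ cr > (0 : ℝ), ∃ CB > (0 : ℝ), ∃ Cρ > (0 : ℝ),
    ∀ cr' : ℝ, 0 < cr' → cr' ≤ cr →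
    ∃ CT > (0 : ℝ), ∀ AT : ℝ, CT ≤ AT →
    ∃ CT' > (0 : ℝ), ∀ AT' : ℝ, CT' ≤ AT' →
    ∀ (N l : ℕ), 2 ≤ l →
    ∃ d₀ : ℕ, ∀ d : ℕ, d₀ ≤ d →
    ∀ (n m k B T T' : ℕ) (ηe ηr ρ : ℝ)
      (P : Fin d → MoE.Vec d) (o : Bool → Fin d)
      (D : MeasureTheory.Measure (MoE.Sample d n)) [MeasureTheory.IsProbabilityMeasure D]
      (a : Fin k → Bool) (θ₀ : MoE.Weights d m k),
      l ≤ n → 1 ≤ m → (k : ℝ) ≤ Kk * √(d : ℝ) →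
      Orthonormal ℝ P →
      MoE.IsDataModel κ K o D →
      (∀ b, β * (k : ℝ) ≤ ((MoE.headSet a b).card : ℝ)) →
      MoE.IsPretrained p₀ cp φ C₂ P l o D a θ₀ →
      0 < ηe → ηe ≤ E →
      cr' * (ηe / (m * d * (l : ℝ) ^ 2)) ≤ ηr → ηr ≤ cr * (ηe / (m * d * (l : ℝ) ^ 2)) →
      CB * ((l : ℝ) ^ 2 * (d : ℝ) ^ 2) ≤ B →
      CT * ((l : ℝ) ^ 2 * √(d * Real.log l) / ηe) ≤ T →
      (T : ℝ) ≤ AT * ((l : ℝ) ^ 2 * √(d * Real.log l) / ηe) →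
      CT' * (k * (l : ℝ) ^ 2 * √(Real.log l) / ηe) ≤ T' →
      (T' : ℝ) ≤ AT' * (k * (l : ℝ) ^ 2 * √(Real.log l) / ηe) →
      0 ≤ ρ → ρ ≤ 1 - Cρ / k →
      1 - 1 / (d : ℝ) ^ N ≤
        (MoE.batchLaw B D).real
          {ω | ∀ R : Finset (Fin k),
            MoE.IsKept a ρ
              (MoE.normChange θ₀ (MoE.sgd P l a ηr ηe Finset.univ ω θ₀ T)) R →
            ∀ᵐ z ∂D,
              0 < MoE.sgn z.2 *
                MoE.output l a R (MoE.prunedWeights P l a ηr ηe R ω θ₀ T T')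
                  (MoE.tokens P z)} := by
  have ha₀ : 0 < κ * p₀ := mul_pos hκ hp₀
  set a₀ := κ * p₀
  set C := |C₂| + 1 with hC_def
  have hC1 : 1 ≤ C := by linarith [abs_nonneg C₂]
  have hC : 0 < C := by linarith
  set cr := cp / (4 * (C * (8 * C / (φ * a₀) + |E|))) with hcr_def
  have hcr : 0 < cr := by
    have := abs_nonneg E
    positivity
  -- The value of `Cρ` makes `(1 - ρ) * k ≥ 1` and `(1 - ρ) * (β * k) ≥ 2`, as needed for the
  -- roundings in the pruning.
  refine ⟨cr, hcr, 1, one_pos, 2 / β + 1, by positivity, fun cr' hcr' _ => ?_⟩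
  -- The first term makes the important routers grow, the last lets one important expert beat `k`
  -- opposing ones, and the summand `1` gives `CT ≤ CT ^ 2`.
  set CT := 3840 / (cr' * φ * a₀ ^ 2) + 1 + 8 * (|Kk| + 1) * C / (φ * a₀) with hCT_def
  have hCT1 : 3840 / (cr' * φ * a₀ ^ 2) + 1 ≤ CT := by
    have : 0 ≤ 8 * (|Kk| + 1) * C / (φ * a₀) := by positivity
    linarith
  have hCT2 : 8 * (|Kk| + 1) * C / (φ * a₀) ≤ CT := by
    have : 0 ≤ 3840 / (cr' * φ * a₀ ^ 2) := by positivity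
    linarith
  have hCT3 : 3840 / (cr' * φ * a₀ ^ 2) ≤ CT ^ 2 := by
    have : 0 ≤ 3840 / (cr' * φ * a₀ ^ 2) := by positivity
    nlinarith
  have hCT : 0 < CT := lt_of_lt_of_le (by positivity) hCT1
  refine ⟨CT, hCT, fun AT hAT => ⟨1, one_pos, fun AT' hAT' N l hl => ?_⟩⟩
  have hAT0 : 0 < AT := hCT.trans_le hAT
  have hl2 : (2 : ℝ) ≤ l := by exact_mod_cast hl
  have hl0 : (0 : ℝ) < l := zero_lt_two.trans_le hl2
  have hl1 : (1 : ℝ) ≤ l := one_le_two.trans hl2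
  have hlog2 := Real.log_pos (show (1 : ℝ) < 2 by norm_num)
  have hlog : Real.log 2 ≤ Real.log l := Real.log_le_log (by norm_num) hl2
  set L := Real.log l with hL_def
  have hL : 0 < L := by linarith
  set y := √L
  have hy2 : y ^ 2 = L := Real.sq_sqrt hL.le
  have hy : 1 / 2 ≤ y := Real.le_sqrt_of_sq_le (by
    linarith [Real.log_two_gt_d9])
  -- By `k ≤ Kk * √d`, both training phases have length of order `√d / ηe`; `M` is the resulting
  -- constant.
  set M := (AT + AT' * |Kk|) * ((l : ℝ) ^ 2 * y) with hM_def
  have hM : 0 ≤ M := by positivity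
  set δ := Real.log 2 / 16
  have hδ : 0 < δ := by positivity
  set D₀ := cr * M * (C + M)
  set γ := 1 / (2 * (l : ℝ) * (Real.exp (L + D₀ + δ) + l))
  have hγ0 : 0 < γ := by positivity
  obtain ⟨hγl, hγ⟩ := gate_slack hl2 (Real.exp_pos (L + D₀ + δ))
  set α := φ * a₀ / (4 * l) with hα_def
  have hα : 0 < α := by positivity
  set κ₁ := 2 * (2 * C / α + |E|) with hκ₁_def
  have hκ₁ : 0 ≤ κ₁ := by positivity
  -- The allowed frequency of irrelevant patterns is `η / √d`. The conditions serve, in order, the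
  -- neuron motion, the router drift, the late margin, the early margin and the precision of the
  -- counts. As the true frequency is at most `K / d`, any fixed `η` is admissible for large `d`.
  obtain ⟨η, hη, hη1, hη2, hη3, hη4, hη5⟩ : ∃ η : ℝ, 0 < η ∧ M * η ≤ 1 ∧
      cr * M * (C + M) * η ≤ δ / 2 ∧ (1 + α) * η ≤ γ * α * a₀ / 64 ∧
      cr * κ₁ * (C + κ₁) * η ≤ cp / 4 ∧ 1 * η ≤ a₀ / 8 := by
    refine Eventually.exists (f := 𝓝[>] (0 : ℝ)) ?_
    filter_upwards [self_mem_nhdsWithin, eventually_mul_le_nhdsGT M one_pos,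
      eventually_mul_le_nhdsGT (cr * M * (C + M)) (half_pos hδ),
      eventually_mul_le_nhdsGT (1 + α) (show 0 < γ * α * a₀ / 64 by positivity),
      eventually_mul_le_nhdsGT (cr * κ₁ * (C + κ₁)) (show 0 < cp / 4 by positivity),
      eventually_mul_le_nhdsGT 1 (show 0 < a₀ / 8 by positivity)] with η h0 h1 h2 h3 h4 h5
    exact ⟨h0, h1, h2, h3, h4, h5⟩
  obtain ⟨d₀, hd₀⟩ := eventually_atTop.1 <| (eventually_le_sqrt 1).and <|
    (eventually_le_sqrt (2 * K / η)).and <| (eventually_le_sqrt (2 * (cr * M) * C / δ)).and <|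
    (eventually_le_sqrt (cp / Real.log 2)).and <|
    (eventually_le_sqrt (κ₁ / (CT * ((l : ℝ) ^ 2 * y)))).and <|
    (eventually_le_sqrt (16 * C * cr * AT * l ^ 3 / (β * y) + 1)).and
    (eventually_mul_exp_le N (show 0 < η ^ 2 / 2 by positivity))
  refine ⟨d₀, fun d hd n m k B T T' ηe ηr ρ P o D _ a θ₀ hn hm hk hP hD hβk hθ hηe hηE hr1 hr2 hB
    hT1 hT2 hT'1 hT'2 hρ0 hρ => ?_⟩
  obtain ⟨hx1, hxK, hxδ, hxσ, hxκ, hxY, hprob, hhalf⟩ := hd₀ d hd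
  rw [Real.sqrt_mul (Nat.cast_nonneg d)] at hT1 hT2
  have hxd : √(d : ℝ) ^ 2 = d := Real.sq_sqrt (Nat.cast_nonneg d)
  set x := √(d : ℝ) with hx_def
  have hx : 0 < x := zero_lt_one.trans_le hx1
  have hd0 : (0 : ℝ) < d := by rw [← hxd]; positivity
  have hm0 : (0 : ℝ) < m := by exact_mod_cast hm
  have hB' : (0 : ℝ) < B := lt_of_lt_of_le (by positivity) hB
  have hB0 : 0 < B := by exact_mod_cast hB'
  have hk0 : 0 < k := by
    obtain ⟨s, -⟩ := hθ.important true
    exact s.pos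
  have hk0' : (0 : ℝ) < k := by exact_mod_cast hk0
  have hηE' : ηe ≤ |E| := hηE.trans (le_abs_self E)
  -- learning rates and horizons
  have hr_hi : ηr * m * (d * (l : ℝ) ^ 2) ≤ cr * ηe := by
    calc ηr * m * (d * (l : ℝ) ^ 2)
        ≤ cr * (ηe / (m * d * (l : ℝ) ^ 2)) * m * (d * (l : ℝ) ^ 2) := by gcongr
      _ = cr * ηe := by field_simp
  have hr_lo : cr' * ηe ≤ ηr * m * (d * (l : ℝ) ^ 2) := by
    calc cr' * ηe = cr' * (ηe / (m * d * (l : ℝ) ^ 2)) * m * (d * (l : ℝ) ^ 2) := by field_simp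
      _ ≤ _ := by gcongr
  have hηr : 0 < ηr := lt_of_lt_of_le (by positivity) hr1
  have hT_lo : CT * ((l : ℝ) ^ 2 * (x * y)) ≤ ηe * T := by
    rw [← mul_div_assoc, div_le_iff₀ hηe] at hT1
    linarith only [hT1]
  have hT_hi : ηe * T ≤ AT * ((l : ℝ) ^ 2 * (x * y)) := by
    rw [← mul_div_assoc, le_div_iff₀ hηe] at hT2
    linarith only [hT2]
  have hT'_hi : ηe * T' ≤ AT' * (k * (l : ℝ) ^ 2 * y) := by
    rw [← mul_div_assoc, le_div_iff₀ hηe] at hT'2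
    linarith only [hT'2]
  have hkx : (k : ℝ) ≤ |Kk| * x := hk.trans (mul_le_mul_of_nonneg_right (le_abs_self Kk) hx.le)
  have hH : ηe * (T + T' : ℕ) ≤ M * x := by
    have : AT' * (k * (l : ℝ) ^ 2 * y) ≤ AT' * (|Kk| * x * (l : ℝ) ^ 2 * y) := by gcongr
    push_cast
    rw [hM_def]
    linarith only [this, hT_hi, hT'_hi]
  have hq : ηr * m * (T + T' : ℕ) * x ≤ cr * M :=
    rate_mul_le (l := l) hx hl1 hcr.le (Nat.cast_nonneg _) (by rw [hxd]; exact hr_hi) hH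
      (by positivity)
  have hmH : 0 ≤ ηr * m * (T + T' : ℕ) := by positivity
  have hdrift := drift_le hx hC.le hη.le hM hmH hδ hq hH hx1 hη2 hxδ
  set t₁ := 2 * C / (α * ηe) with ht₁_def
  have ht₁ : α * ηe * t₁ = 2 * C := by rw [ht₁_def]; field_simp
  have ht₁0 : 0 < t₁ := by positivity
  have hκt : ηe * (2 * t₁ + 2) ≤ κ₁ := by
    have : ηe * t₁ = 2 * C / α := by rw [ht₁_def]; field_simp
    rw [hκ₁_def]
    linarith only [this, hηE']
  have hT₁ : 2 * t₁ + 2 ≤ T := by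
    rw [div_le_iff₀ (by positivity)] at hxκ
    have : ηe * (2 * t₁ + 2) ≤ ηe * T := by linarith only [hκt, hxκ, hT_lo]
    exact le_of_mul_le_mul_left this hηe
  have hηx : η / x ≤ η := div_le_self hη.le hx1
  have hexp : Real.exp (-2 * (η / (2 * x)) ^ 2 * B) ≤ Real.exp (-(η ^ 2 / 2 * d)) := by
    rw [← hxd]
    exact exp_batch_le (l := l) hx hl1 (by rw [hxd]; linarith only [hB])
  -- Half of the allowed frequency `η / x` is reserved for the true probability, half for the
  -- fluctuation.
  refine le_trans ?_ (le_batchLaw_real D hB0 hD.task (ι := Fin d ⊕ Bool)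
    (A := Sum.elim (fun q => appears q) fun b =>
      proficientSet P l o b (θ₀.router (hθ.important b).choose)) (δ := η / (2 * x)) (by positivity)
    ?_ fun ω hω hcount => ?_)
  · have hcard : (Fintype.card (Fin d ⊕ Bool) : ℝ) = d + 2 := by simp
    rw [hcard]
    refine sub_le_sub_left (le_trans ?_ hprob) 1
    exact mul_le_mul_of_nonneg_left hexp (by positivity)
  · exact hexp.trans hhalf
  have hgood : GoodRun P o l a ηr ηe (η / x) C δ θ₀ ω (T + T') :=
    { orthonormal := hP
      ne := hD.ne
      two_le := hl
      le_tokens := hn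
      batch_pos := hB0
      ηr_nonneg := hηr.le
      ηe_pos := hηe
      ε_nonneg := by positivity
      one_le := hC1
      neuron_le := fun s r => (hθ.neuron_le s r).trans (by linarith only [le_abs_self C₂, hC_def])
      router_le := hθ.router_le
      isTask := hω
      freq := fun q hqo t => by
        have h1 := (abs_le.1 (hcount (Sum.inl q) t)).2
        simp only [Sum.elim_inl] at h1
        have h2 : D.real (appears q) ≤ η / (2 * x) := by
          refine (hD.freq q hqo).trans ?_
          rw [← hxd]
          exact frequency_le hη hx hxK
        have h3 := mul_le_mul_of_nonneg_right h2 (Nat.cast_nonneg (α := ℝ) t)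
        have h4 : η / x * t = η / (2 * x) * t + η / (2 * x) * t := by field_simp; ring
        linarith only [h1, h3, h4]
      horizon := by
        calc ηe * (η / x) * (T + T' : ℕ) = ηe * (T + T' : ℕ) * (η / x) := by ring
          _ ≤ M * x * (η / x) := by gcongr
          _ = M * η := by field_simp
          _ ≤ 1 := hη1
      δ_le := le_rfl
      drift := hdrift }
  have himp : ∀ b, ∃ s, a s = b ∧ 3 / 2 * L ≤
        inner ℝ ((sgd P l a ηr ηe Finset.univ ω θ₀ T).router s) (P (o (a s))) ∧
      m * α * ηe * T ≤ act ((sgd P l a ηr ηe Finset.univ ω θ₀ T).neuron s) (P (o (a s))) := by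
    intro b
    obtain ⟨hs, himp⟩ := (hθ.important b).choose_spec
    have hc := fun t => hcount (Sum.inr b) t
    simp only [Sum.elim_inr] at hc
    generalize (hθ.important b).choose = s at hs himp hc
    subst hs
    refine ⟨s, rfl, ?_⟩
    refine hgood.important (σ := cp / d) (γ := γ) (D := D₀) (φ := φ) (α := α) (t₁ := t₁)
      himp.separated himp.active
      (fun t => (hc t).trans ?_) ha₀ (le_measureReal_proficientSet hp₀.le (hD.class_prob _) himp.prof)
      hφ (by positivity) ?_ hα_def ht₁
      (router_range_le hC.le hM hmH hq hH hx1) hγ0.le hγl hγ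
      (drop_le hd0 hl1 hC hφ ha₀ hcp hcr_def hα_def ht₁ hηe hηE' hr_hi)
      (early_drift_le hd0 hx1 hl1 hC.le hη.le hcr.le ht₁0.le hηe hκt (by positivity)
        hr_hi hη4) ?_ hT₁ (Nat.le_add_right _ _) ?_
    · refine mul_le_mul_of_nonneg_right ?_ (Nat.cast_nonneg t)
      have : η / (2 * x) ≤ η := div_le_self hη.le (by linarith only [hx1])
      linarith only [this, hη5]
    · rw [← hxd]
      exact separation_le hlog2 hx1 hxσ
    · refine le_trans ?_ hη3
      gcongr
    · rw [← hL_def, ← hy2]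
      exact growth_le hl0 hx (by positivity) hcr' hφ ha₀ hCT.le hα_def hηe hCT3 (by rwa [hxd]) hT_lo
  intro R hR
  filter_upwards [hD.task] with z hz
  have hρ' : (2 / β + 1) ≤ (1 - ρ) * k := by
    have h1 : (2 / β + 1) / k ≤ 1 - ρ := by linarith only [hρ]
    rwa [div_le_iff₀ hk0'] at h1
  -- The denominator of `Y` contains the bound `cr * (AT * (l ^ 2 * y))` for `ηr * m * T * x`, so
  -- that `ηr * T * Y ≤ log l / 4`; for fixed `l`, `Y` is of order `m * √d`.
  refine hgood.output_pos (X := m * α * ηe * T) 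
    (Y := m * x * y ^ 2 / (4 * (cr * (AT * ((l : ℝ) ^ 2 * y))))) himp
    (harm_lt hl0 hx hy hφ hm0 ha₀ hC hα_def hCT2 hk hT_lo) (by positivity) (by positivity)
    ?_ ?_ hβk ?_ ?_ hR hz
  · rw [← hL_def, ← hy2]
    refine rate_mul_activation_le (by positivity) ?_
    exact rate_mul_le (l := l) hx hl1 hcr.le (Nat.cast_nonneg _)
      (by rw [hxd]; exact hr_hi) (by linarith only [hT_hi]) (by positivity)
  · exact harm_lt_activation hm0 hl0 (one_half_pos.trans_le hy) hβ hcr hAT0 hxY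
  · have : 0 ≤ 2 / β := by positivity
    linarith only [this, hρ']
  · have h1 := mul_le_mul_of_nonneg_left hρ' hβ.le
    have h2 : β * (2 / β + 1) = 2 + β := by field_simp
    linarith only [h1, h2, hβ]
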